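/- Let $G=\mathrm{GL}_2(\mathbb{Q}_2)$, $K=\mathrm{GL}_2(\mathbb{Z}_2)$, let $\bar{\mathbb{Z}}_2$ be the valuation ring of $\bar{\mathbb{Q}}_2$, with residue field $\bar{\mathbb{F}}_2$, and let $v$ be the valuation of $\bar{\mathbb{Q}}_2$ with $v(2)=1$. For a $\mathbb{Z}_2$-algebra $R$, let $\mathrm{Sym}^rR^2$ be the space of homogeneous polynomials of degree $r$ in $X,Y$ over $R$, with $\begin{pmatrix}a&b\\c&d\end{pmatrix}\cdot f(X,Y)=f(aX+cY,bX+dY)$ for matrices in $K$, extended to $K\mathbb{Q}_2^\times$ by letting the scalar matrix $2$ act trivially. Let $\mathcal{I}=\mathrm{ind}_{K\mathbb{Q}_2^\times}^{G}$ be compact induction, let $[g,w]$ denote the function supported on $K\mathbb{Q}_2^\times g^{-1}$ with $[g,w](g')=(g'g)\cdot w$ there, and let $T$ be the Hecke operator on $\mathcal{I}(\mathrm{Sym}^rR^2)$, $$T[g,w(X,Y)]=\sum_{\mu\in\{0,1\}}\left[g\begin{pmatrix}2&\mu\\0&1\end{pmatrix},w(X,2Y-\mu X)\right]+\left[g\begin{pmatrix}1&0\\0&2\end{pmatrix},w(2X,Y)\right].$$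 Put $V_r=\mathrm{Sym}^r\bar{\mathbb{F}}_2^2$, $\theta=X^2Y-XY^2$, and $V_r^{(n)}=\theta^nV_{r-3n}$ (zero if $r<3n$). For $\lambda\in\bar{\mathbb{F}}_2$ let $\pi(0,\lambda,1)=\mathcal{I}(V_0)/(T-\lambda)\mathcal{I}(V_0)$. For $a_2\in\bar{\mathbb{Q}}_2$ let $$\Theta=\frac{\mathcal{I}(\mathrm{Sym}^r\bar{\mathbb{Z}}_2^2)}{(T-a_2)\,\mathcal{I}(\mathrm{Sym}^r\bar{\mathbb{Q}}_2^2)\cap\mathcal{I}(\mathrm{Sym}^r\bar{\mathbb{Z}}_2^2)},\qquad \bar\Theta=\Theta\otimes_{\bar{\mathbb{Z}}_2}\bar{\mathbb{F}}_2,$$ and let $P:\mathcal{I}(V_r)\to\bar\Theta$ be the natural surjection. Let $\bar\Theta_0=P(\mathcal{I}(V_r^{(1)}))$. Let $W\subseteq V_r^{(1)}$ be the span of $V_r^{(2)}$, $\theta X^{r-3}$ and $\theta Y^{r-3}$ (so that $W/V_r^{(2)}\cong V_1$ and $V_r^{(1)}/W\cong V_0$, the latter through the map $\theta X^{r-3-j}Y^j\mapsto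 1$ if $0<j<r-3$ and $\mapsto 0$ if $j\in\{0,r-3\}$). Let $\mathcal{F}'_2=P(\mathcal{I}(W))$ and $\mathcal{F}'_3=\bar\Theta_0/\mathcal{F}'_2$. Let $r\ge 6$ be even and $v(a_2)=1$, and let $\lambda\in\bar{\mathbb{F}}_2^\times$ be the residue class of the unit $a_2/2$. Then $\mathcal{F}'_3$ is a quotient of $\pi(0,\lambda,1)$ as a representation of $G$ over $\bar{\mathbb{F}}_2$: the surjection $\mathcal{I}(V_r^{(1)})\to\bar\Theta_0\to\mathcal{F}'_3$ induced by $P$ is the composition of the projection $\mathcal{I}(V_r^{(1)})\to\mathcal{I}(V_0)\to\pi(0,\lambda,1)$ with a surjective $G$-equivariant $\bar{\mathbb{F}}_2$-linear map $\pi(0,\lambda,1)\to\mathcal{F}'_3$. -/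

import Mathlib

open MvPolynomial
open scoped TensorProduct

noncomputable section

namespace BT2

/-! ### The groups `G = GL₂(ℚ₂)`, `K = GL₂(ℤ₂)` and `K ℚ₂ˣ` -/

/-- `G = GL₂(ℚ₂)`. -/
abbrev G := GL (Fin 2) ℚ_[2]

/-- `K = GL₂(ℤ₂)`. -/
abbrev K := GL (Fin 2) ℤ_[2]

/-- The inclusion `K → G`. -/
def incl : K →* G := Matrix.GeneralLinearGroup.map (algebraMap ℤ_[2] ℚ_[2])

/-- The scalar matrix `2` in `G`. -/
def two : G := Matrix.GeneralLinearGroup.scalar (Fin 2) (Units.mk0 (2 : ℚ_[2]) two_ne_zero)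

lemma two_comm (g : G) : two * g = g * two :=
  Matrix.GeneralLinearGroup.scalar_commute _ _

lemma zpow_two_comm (n : ℤ) (g : G) : two ^ n * g = g * two ^ n :=
  (show Commute two g from two_comm g).zpow_left n

/-- The subgroup `K ℚ₂ˣ` of `G`; since `ℚ₂ˣ = ℤ₂ˣ × 2^ℤ`, it is `K · 2^ℤ`. -/
def KZ : Subgroup G where
  carrier := {h | ∃ (k : K) (n : ℤ), h = incl k * two ^ n}
  one_mem' := ⟨1, 0, by simp⟩
  mul_mem' := by
    rintro _ _ ⟨k, n, rfl⟩ ⟨k', m, rfl⟩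
    refine ⟨k * k', n + m, ?_⟩
    rw [map_mul, zpow_add, mul_assoc, ← mul_assoc (two ^ n), zpow_two_comm]
    simp only [mul_assoc]
  inv_mem' := by
    rintro _ ⟨k, n, rfl⟩
    refine ⟨k⁻¹, -n, ?_⟩
    rw [mul_inv_rev, map_inv, ← zpow_neg, zpow_two_comm]

lemma mem_KZ {h : G} : h ∈ KZ ↔ ∃ (k : K) (n : ℤ), h = incl k * two ^ n := Iff.rfl

lemma incl_mem (k : K) : incl k ∈ KZ := ⟨k, 0, by simp⟩

lemma two_mem : two ∈ KZ := ⟨1, 1, by simp⟩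

lemma incl_injective : Function.Injective incl := by
  intro k k' h
  ext i j
  have := congrArg (fun g : G => (g : Matrix (Fin 2) (Fin 2) ℚ_[2]) i j) h
  exact Subtype.ext this

lemma det_incl (k : K) : (incl k : Matrix (Fin 2) (Fin 2) ℚ_[2]).det
    = (((k : Matrix (Fin 2) (Fin 2) ℤ_[2]).det : ℤ_[2]) : ℚ_[2]) := by
  have := RingHom.map_det (algebraMap ℤ_[2] ℚ_[2]) (k : Matrix (Fin 2) (Fin 2) ℤ_[2])
  exact this.symm

lemma norm_det_incl (k : K) : ‖(incl k : Matrix (Fin 2) (Fin 2) ℚ_[2]).det‖ = 1 := by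
  rw [det_incl]
  have : IsUnit (k : Matrix (Fin 2) (Fin 2) ℤ_[2]).det :=
    (Matrix.isUnit_iff_isUnit_det _).1 k.isUnit
  simpa using PadicInt.isUnit_iff.1 this

lemma det_two : (two : Matrix (Fin 2) (Fin 2) ℚ_[2]).det = 4 := by
  simp [two, Matrix.GeneralLinearGroup.coe_scalar]
  norm_num

lemma norm_det_two_zpow (n : ℤ) :
    ‖((two ^ n : G) : Matrix (Fin 2) (Fin 2) ℚ_[2]).det‖ = (4⁻¹ : ℝ) ^ n := by
  have h : ((two ^ n : G) : Matrix (Fin 2) (Fin 2) ℚ_[2]).det = 4 ^ n := by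
    have h1 := map_zpow (Matrix.GeneralLinearGroup.det (n := Fin 2) (R := ℚ_[2])) two n
    have h2 := congrArg (fun u : ℚ_[2]ˣ => (u : ℚ_[2])) h1
    simp only [Units.val_zpow_eq_zpow_val] at h2
    rw [← det_two]
    exact h2
  have h4 : ‖(4 : ℚ_[2])‖ = 4⁻¹ := by
    have : (4 : ℚ_[2]) = ((2 : ℕ) : ℚ_[2]) ^ 2 := by norm_num
    rw [this, norm_pow, Padic.norm_p]
    norm_num
  rw [h, norm_zpow, h4]

lemma KZ_unique {k k' : K} {n m : ℤ} (h : incl k * two ^ n = incl k' * two ^ m) : k = k' := by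
  have h1 := congrArg (fun g : G => ‖(g : Matrix (Fin 2) (Fin 2) ℚ_[2]).det‖) h
  simp only [Matrix.GeneralLinearGroup.coe_mul, Matrix.det_mul, norm_mul, norm_det_incl, one_mul,
    norm_det_two_zpow] at h1
  have h2 : n = m := zpow_right_injective₀ (by norm_num) (by norm_num) h1
  subst h2
  exact incl_injective (mul_right_cancel h)

lemma apply_two_zpow {β : Type*} {f : G → β} (hf : ∀ x, f (two * x) = f x) (n : ℤ) (x : G) :
    f (two ^ n * x) = f x := by
  induction n with
  | zero => simp
  | succ n ih => rw [add_comm, zpow_add, zpow_one, mul_assoc, hf, ih]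
  | pred n ih =>
    rw [← hf, ← mul_assoc, ← zpow_one_add, show (1 : ℤ) + (-(n : ℤ) - 1) = -n by ring, ih]

/-- The `K`-component of an element of `K ℚ₂ˣ = K · 2^ℤ`. -/
def kpart (h : G) : K := by
  classical
  exact if hh : h ∈ KZ then (mem_KZ.1 hh).choose else 1

lemma kpart_eq (k : K) (n : ℤ) : kpart (incl k * two ^ n) = k := by
  have hh : incl k * two ^ n ∈ KZ := ⟨k, n, rfl⟩
  have h := (mem_KZ.1 hh).choose_spec
  obtain ⟨m, hm⟩ := h
  rw [kpart, dif_pos hh]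
  exact (KZ_unique hm).symm

lemma kpart_incl_mul (k : K) {h : G} (hh : h ∈ KZ) : kpart (incl k * h) = k * kpart h := by
  obtain ⟨k', n, rfl⟩ := hh
  rw [← mul_assoc, ← map_mul, kpart_eq, kpart_eq]

lemma kpart_two_mul {h : G} (hh : h ∈ KZ) : kpart (two * h) = kpart h := by
  obtain ⟨k', n, rfl⟩ := hh
  rw [two_comm, mul_assoc, ← zpow_add_one, kpart_eq, kpart_eq]

/-! ### Binary forms and the action of `2 × 2` matrices over `ℤ₂` -/

section Forms

variable (R : Type*) [CommRing R]

/-- Polynomials in two variables `X = X 0` and `Y = X 1`. -/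
abbrev Poly := MvPolynomial (Fin 2) R

/-- `Sym^r R²`: the homogeneous polynomials of degree `r` in `X`, `Y`. -/
abbrev Sym (r : ℕ) : Submodule R (Poly R) := homogeneousSubmodule (Fin 2) R r

/-- `G` acts on functions on `G` by right translation. -/
def translation : Representation R G (G → Poly R) where
  toFun g := LinearMap.funLeft R (Poly R) (fun x => x * g)
  map_one' := by
    ext f x
    simp [LinearMap.funLeft]
  map_mul' g h := by
    ext f x
    simp [LinearMap.funLeft, mul_assoc]

variable {R} in
lemma translation_apply (g : G) (f : G → Poly R) (x : G) : translation R g f x = f (x * g) := rfl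

variable [Algebra ℤ_[2] R]

/-- The substitution `(a b; c d) · f (X, Y) = f (a X + c Y, b X + d Y)`. -/
def act (M : Matrix (Fin 2) (Fin 2) ℤ_[2]) : Poly R →ₐ[R] Poly R :=
  aeval fun j => ∑ i, C (algebraMap ℤ_[2] R (M i j)) * X i

variable {R}

lemma act_X (M : Matrix (Fin 2) (Fin 2) ℤ_[2]) (j : Fin 2) :
    act R M (X j) = ∑ i, C (algebraMap ℤ_[2] R (M i j)) * X i := by
  simp [act]

lemma act_C (M : Matrix (Fin 2) (Fin 2) ℤ_[2]) (c : R) : act R M (C c) = C c := by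
  simp [act]

lemma act_mul (M N : Matrix (Fin 2) (Fin 2) ℤ_[2]) (f : Poly R) :
    act R (M * N) f = act R M (act R N f) := by
  suffices h : act R (M * N) = (act R M).comp (act R N) by rw [h]; rfl
  apply MvPolynomial.algHom_ext
  intro j
  simp only [AlgHom.comp_apply, act_X, map_mul, act_C, Matrix.mul_apply,
    Fin.sum_univ_two, map_add]
  ring

lemma act_one (f : Poly R) : act R 1 f = f := by
  suffices h : act R 1 = AlgHom.id R (Poly R) by rw [h]; rfl
  apply MvPolynomial.algHom_ext
  intro j
  fin_cases j <;> simp [act_X]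

lemma act_inv_act (k : K) (f : Poly R) : act R (k⁻¹ : K) (act R k f) = f := by
  rw [← act_mul, ← Matrix.GeneralLinearGroup.coe_mul, inv_mul_cancel,
    Matrix.GeneralLinearGroup.coe_one, act_one]

lemma act_mem_Sym (M : Matrix (Fin 2) (Fin 2) ℤ_[2]) {r : ℕ} {f : Poly R} (hf : f ∈ Sym R r) :
    act R M f ∈ Sym R r := by
  rw [mem_homogeneousSubmodule] at hf ⊢
  have := hf.aeval (n := 1) (fun j => ∑ i, C (algebraMap ℤ_[2] R (M i j)) * X i) (fun j => by
    refine MvPolynomial.IsHomogeneous.sum _ _ _ (fun i _ => ?_)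
    simpa using (isHomogeneous_C (Fin 2) (algebraMap ℤ_[2] R (M i j))).mul
      (isHomogeneous_X R i))
  simpa [act] using this

/-! ### Compact induction -/

/-- The compact induction `𝓘(W) = ind_{K ℚ₂ˣ}^G W` of a (`K`-stable) space `W` of polynomials,
the scalar matrix `2` acting trivially: the functions `f : G → W` with `f (k x) = k · f (x)` for
`k ∈ K`, `f (2 x) = f (x)`, supported on finitely many cosets `K ℚ₂ˣ s`. -/
def cInd (W : Submodule R (Poly R)) : Subrepresentation (translation R) where
  toSubmodule :=
  { carrier := {f | (∀ x, f x ∈ W) ∧ (∀ (k : K) (x : G), f (incl k * x) = act R k (f x)) ∧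
      (∀ x, f (two * x) = f x) ∧ ∃ S : Finset G, ∀ x, f x ≠ 0 → ∃ s ∈ S, x * s⁻¹ ∈ KZ}
    zero_mem' := ⟨fun _ => W.zero_mem, by simp, by simp, ∅, by simp⟩
    add_mem' := by
      classical
      rintro f g ⟨hf1, hf2, hf3, S, hS⟩ ⟨hg1, hg2, hg3, S', hS'⟩
      refine ⟨fun x => W.add_mem (hf1 x) (hg1 x), fun k x => by simp [hf2, hg2],
        fun x => by simp [hf3, hg3], S ∪ S', fun x hx => ?_⟩
      by_cases h : f x = 0
      · have h' : g x ≠ 0 := fun h' => hx (by simp [h, h'])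
        obtain ⟨s, hs, h2⟩ := hS' x h'
        exact ⟨s, by simp [hs], h2⟩
      · obtain ⟨s, hs, h2⟩ := hS x h
        exact ⟨s, by simp [hs], h2⟩
    smul_mem' := by
      rintro c f ⟨hf1, hf2, hf3, S, hS⟩
      refine ⟨fun x => W.smul_mem c (hf1 x), fun k x => by simp [hf2],
        fun x => by simp [hf3], S, fun x hx => hS x (fun h => hx (by simp [h]))⟩ }
  apply_mem_toSubmodule := by
    classical
    rintro g f ⟨hf1, hf2, hf3, S, hS⟩
    refine ⟨fun x => hf1 _, fun k x => ?_, fun x => ?_, S.image (fun s => s * g⁻¹), fun x hx => ?_⟩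
    · rw [translation_apply, translation_apply, mul_assoc, hf2]
    · rw [translation_apply, translation_apply, mul_assoc, hf3]
    · obtain ⟨s, hs, h2⟩ := hS _ hx
      refine ⟨s * g⁻¹, Finset.mem_image_of_mem _ hs, ?_⟩
      simpa [mul_assoc] using h2

lemma mem_cInd {W : Submodule R (Poly R)} {f : G → Poly R} :
    f ∈ (cInd W).toSubmodule ↔
      (∀ x, f x ∈ W) ∧ (∀ (k : K) (x : G), f (incl k * x) = act R k (f x)) ∧
      (∀ x, f (two * x) = f x) ∧ ∃ S : Finset G, ∀ x, f x ≠ 0 → ∃ s ∈ S, x * s⁻¹ ∈ KZ := Iff.rfl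

lemma apply_KZ {W : Submodule R (Poly R)} {f : G → Poly R} (hf : f ∈ (cInd W).toSubmodule)
    {h : G} (hh : h ∈ KZ) (x : G) : f (h * x) = act R (kpart h) (f x) := by
  obtain ⟨k, n, rfl⟩ := hh
  rw [kpart_eq, mul_assoc, hf.2.1, apply_two_zpow hf.2.2.1]

/-- The elementary function `[g, v]`, supported on `K ℚ₂ˣ g⁻¹`, with `[g, v] (x) = (x g) · v`
there. -/
def elem (g : G) (v : Poly R) : G → Poly R := by
  classical
  exact fun x => if x * g ∈ KZ then act R (kpart (x * g)) v else 0

lemma elem_mem {W : Submodule R (Poly R)} (hW : ∀ (k : K), ∀ v ∈ W, act R k v ∈ W)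
    (g : G) {v : Poly R} (hv : v ∈ W) : elem g v ∈ (cInd W).toSubmodule := by
  classical
  refine ⟨fun x => ?_, fun k x => ?_, fun x => ?_, {g⁻¹}, fun x hx => ?_⟩
  · unfold elem
    split_ifs
    · exact hW _ _ hv
    · exact W.zero_mem
  · unfold elem
    by_cases h : x * g ∈ KZ
    · rw [if_pos h, mul_assoc, if_pos (KZ.mul_mem (incl_mem k) h), kpart_incl_mul k h,
        Matrix.GeneralLinearGroup.coe_mul, act_mul]
    · rw [if_neg h, mul_assoc, if_neg (fun h' => h ((KZ.mul_mem_cancel_left (incl_mem k)).1 h')),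
        map_zero]
  · unfold elem
    by_cases h : x * g ∈ KZ
    · rw [if_pos h, mul_assoc, if_pos (KZ.mul_mem two_mem h), kpart_two_mul h]
    · rw [if_neg h, mul_assoc, if_neg (fun h' => h ((KZ.mul_mem_cancel_left two_mem).1 h'))]
  · refine ⟨g⁻¹, by simp, ?_⟩
    by_contra h
    rw [inv_inv] at h
    exact hx (by simp [elem, h])

end Forms

/-! ### The Hecke operator -/

/-- The matrices `(2 μ; 0 1)` for `μ = 0, 1` and `(1 0; 0 2)`, with entries in `ℤ₂`. -/
def heckeMat : Fin 3 → Matrix (Fin 2) (Fin 2) ℤ_[2] :=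
  ![!![2, 0; 0, 1], !![2, 1; 0, 1], !![1, 0; 0, 2]]

lemma det_heckeMat (i : Fin 3) : (heckeMat i).det = 2 := by
  fin_cases i <;> simp [heckeMat, Matrix.det_fin_two]

/-- The matrices `heckeMat i` as elements of `G`. -/
def heckeG (i : Fin 3) : G :=
  Matrix.GeneralLinearGroup.mkOfDetNeZero ((algebraMap ℤ_[2] ℚ_[2]).mapMatrix (heckeMat i)) (by
    rw [← RingHom.map_det, det_heckeMat, map_ofNat]
    exact two_ne_zero)

lemma coe_heckeG (i : Fin 3) : (heckeG i : Matrix (Fin 2) (Fin 2) ℚ_[2]) =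
    (algebraMap ℤ_[2] ℚ_[2]).mapMatrix (heckeMat i) := rfl

lemma coe_incl (k : K) : (incl k : Matrix (Fin 2) (Fin 2) ℚ_[2]) =
    (algebraMap ℤ_[2] ℚ_[2]).mapMatrix (k : Matrix (Fin 2) (Fin 2) ℤ_[2]) := rfl

lemma coe_two : (two : Matrix (Fin 2) (Fin 2) ℚ_[2]) = Matrix.scalar (Fin 2) (2 : ℚ_[2]) := rfl

lemma mapMatrix_injective {M N : Matrix (Fin 2) (Fin 2) ℤ_[2]}
    (h : (algebraMap ℤ_[2] ℚ_[2]).mapMatrix M = (algebraMap ℤ_[2] ℚ_[2]).mapMatrix N) : M = N := by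
  ext i j
  have := congrArg (fun g => g i j) h
  exact Subtype.ext this

lemma even_or_odd (x : ℤ_[2]) : ∃ y, x = 2 * y ∨ x = 2 * y + 1 := by
  obtain ⟨h1, h2⟩ := PadicInt.zmodRepr_spec x
  rw [PadicInt.maximalIdeal_eq_span_p, Ideal.mem_span_singleton] at h2
  obtain ⟨y, hy⟩ := h2
  refine ⟨y, ?_⟩
  push_cast at hy
  interval_cases h : x.zmodRepr
  · left; simpa using hy
  · right; rw [← hy]; simp

lemma two_mul_ne_one (y : ℤ_[2]) : (2 : ℤ_[2]) * y ≠ 1 := by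
  intro h
  have h1 : IsUnit ((2 : ℕ) : ℤ_[2]) := IsUnit.of_mul_eq_one y (by exact_mod_cast h)
  exact PadicInt.prime_p.not_isUnit h1

/-- A matrix over `ℤ₂` with invertible determinant, as an element of `K`. -/
lemma exists_K {M : Matrix (Fin 2) (Fin 2) ℤ_[2]} (h : IsUnit M.det) :
    ∃ k : K, (k : Matrix (Fin 2) (Fin 2) ℤ_[2]) = M :=
  ⟨Matrix.GeneralLinearGroup.mk'' M h, rfl⟩

lemma two_ne : (2 : ℤ_[2]) ≠ 0 := two_ne_zero

lemma exists_row (M : Matrix (Fin 2) (Fin 2) ℤ_[2]) {u : ℤ_[2]} (hu : IsUnit u)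
    (hM : M.det = 2 * u) : ∃ (i : Fin 3) (k : K), M = heckeMat i * k := by
  suffices h : ∃ (i : Fin 3) (N : Matrix (Fin 2) (Fin 2) ℤ_[2]), M = heckeMat i * N by
    obtain ⟨i, N, hN⟩ := h
    have hd : N.det = u := by
      rw [hN, Matrix.det_mul, det_heckeMat] at hM
      exact mul_left_cancel₀ two_ne hM
    obtain ⟨k, hk⟩ := exists_K (M := N) (by rw [hd]; exact hu)
    exact ⟨i, k, by rw [hk, hN]⟩
  have key : ∀ a b c d : ℤ_[2], M = !![a, b; c, d] →
      ∃ (i : Fin 3) (N : Matrix (Fin 2) (Fin 2) ℤ_[2]), M = heckeMat i * N := by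
    intro a b c d h
    have hdet : a * d - b * c = 2 * u := by rw [← hM, h, Matrix.det_fin_two_of]
    obtain ⟨a', ha⟩ := even_or_odd a
    obtain ⟨b', hb⟩ := even_or_odd b
    obtain ⟨c', hc⟩ := even_or_odd c
    obtain ⟨d', hd⟩ := even_or_odd d
    have h0 : a = 2 * a' → b = 2 * b' →
        ∃ (i : Fin 3) (N : Matrix (Fin 2) (Fin 2) ℤ_[2]), M = heckeMat i * N := fun h1 h2 =>
      ⟨0, !![a', b'; c, d], by rw [h, h1, h2]; simp [heckeMat]⟩
    have h2 : c = 2 * c' → d = 2 * d' →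
        ∃ (i : Fin 3) (N : Matrix (Fin 2) (Fin 2) ℤ_[2]), M = heckeMat i * N := fun h1 h2 =>
      ⟨2, !![a, b; c', d'], by rw [h, h1, h2]; simp [heckeMat]⟩
    have h1 : ∀ s t, a = 2 * s + c → b = 2 * t + d →
        ∃ (i : Fin 3) (N : Matrix (Fin 2) (Fin 2) ℤ_[2]), M = heckeMat i * N := fun s t h1 h2 =>
      ⟨1, !![s, t; c, d], by rw [h, h1, h2]; simp [heckeMat]⟩
    rcases ha with ha | ha <;> rcases hb with hb | hb <;> rcases hc with hc | hc <;>
      rcases hd with hd | hd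
    · exact h0 ha hb
    · exact h0 ha hb
    · exact h0 ha hb
    · exact h0 ha hb
    · exact h2 hc hd
    · exact h1 (a' - c') (b' - d') (by rw [ha, hc]; ring) (by rw [hb, hd]; ring)
    · rw [ha, hb, hc, hd] at hdet
      exact absurd (by linear_combination (1 : ℤ_[2]) * hdet) (two_mul_ne_one
        (2 * a' * d' - 2 * b' * c' - b' - c' - u))
    · rw [ha, hb, hc, hd] at hdet
      exact absurd (by linear_combination (1 : ℤ_[2]) * hdet) (two_mul_ne_one
        (2 * a' * d' + a' - 2 * b' * c' - b' - c' - u))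
    · exact h2 hc hd
    · rw [ha, hb, hc, hd] at hdet
      exact absurd (by linear_combination (-1 : ℤ_[2]) * hdet) (two_mul_ne_one
        (u - 2 * a' * d' - a' - d' + 2 * b' * c'))
    · exact h1 (a' - c') (b' - d') (by rw [ha, hc]; ring) (by rw [hb, hd]; ring)
    · rw [ha, hb, hc, hd] at hdet
      exact absurd (by linear_combination (-1 : ℤ_[2]) * hdet) (two_mul_ne_one
        (u - 2 * a' * d' - a' - d' + 2 * b' * c' + b'))
    · exact h2 hc hd
    · rw [ha, hb, hc, hd] at hdet
      exact absurd (by linear_combination (-1 : ℤ_[2]) * hdet) (two_mul_ne_one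
        (u - 2 * a' * d' - a' - d' + 2 * b' * c' + c'))
    · rw [ha, hb, hc, hd] at hdet
      exact absurd (by linear_combination (1 : ℤ_[2]) * hdet) (two_mul_ne_one
        (2 * a' * d' + d' - 2 * b' * c' - b' - c' - u))
    · exact h1 (a' - c') (b' - d') (by rw [ha, hc]; ring) (by rw [hb, hd]; ring)
  exact key _ _ _ _ (Matrix.eta_fin_two M)

lemma exists_col (M : Matrix (Fin 2) (Fin 2) ℤ_[2]) {u : ℤ_[2]} (hu : IsUnit u)
    (hM : M.det = 2 * u) : ∃ (i : Fin 3) (k : K), M = k * (heckeMat i).adjugate := by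
  obtain ⟨i, k, h⟩ := exists_row M.transpose hu (by rw [Matrix.det_transpose, hM])
  suffices h' : ∃ (j : Fin 3) (N : K), (heckeMat i).transpose = N * (heckeMat j).adjugate by
    obtain ⟨j, N, hN⟩ := h'
    obtain ⟨k', hk'⟩ := exists_K (M := (k : Matrix (Fin 2) (Fin 2) ℤ_[2]).transpose) (by
      rw [Matrix.det_transpose]
      exact (Matrix.isUnit_iff_isUnit_det _).1 k.isUnit)
    refine ⟨j, k' * N, ?_⟩
    rw [Matrix.GeneralLinearGroup.coe_mul, mul_assoc, ← hN, hk', ← Matrix.transpose_mul, ← h,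
      Matrix.transpose_transpose]
  fin_cases i
  · refine ⟨2, 1, ?_⟩
    ext a b
    fin_cases a <;> fin_cases b <;> simp [heckeMat, Matrix.adjugate_fin_two]
  · obtain ⟨N, hN⟩ := exists_K (M := (!![2, 1; 1, 1] : Matrix (Fin 2) (Fin 2) ℤ_[2])) (by
      rw [Matrix.det_fin_two_of]; norm_num)
    refine ⟨1, N, ?_⟩
    rw [hN]
    ext a b
    fin_cases a <;> fin_cases b <;> simp [heckeMat, Matrix.adjugate_fin_two]
    norm_num
  · refine ⟨0, 1, ?_⟩
    ext a b
    fin_cases a <;> fin_cases b <;> simp [heckeMat, Matrix.adjugate_fin_two]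

lemma row_unique {i j : Fin 3} {N : Matrix (Fin 2) (Fin 2) ℤ_[2]}
    (h : heckeMat i = heckeMat j * N) : i = j := by
  rw [Matrix.eta_fin_two N] at h
  have h00 := congrArg (fun M => M 0 0) h
  have h01 := congrArg (fun M => M 0 1) h
  have h10 := congrArg (fun M => M 1 0) h
  have h11 := congrArg (fun M => M 1 1) h
  fin_cases i <;> fin_cases j <;> simp [heckeMat] at h00 h01 h10 h11 ⊢
  · rw [← h11] at h01
    exact two_mul_ne_one (-N 0 1) (by linear_combination h01)
  · exact two_mul_ne_one _ h11.symm
  · exact two_mul_ne_one _ h01.symm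
  · exact two_mul_ne_one _ h11.symm
  · exact two_mul_ne_one _ h00.symm
  · exact two_mul_ne_one (N 0 0) (by rw [← h10] at h00; linear_combination -h00)

lemma col_unique {i j : Fin 3} {N : Matrix (Fin 2) (Fin 2) ℤ_[2]}
    (h : (heckeMat i).adjugate = N * (heckeMat j).adjugate) : i = j := by
  rw [Matrix.eta_fin_two N] at h
  have h00 := congrArg (fun M => M 0 0) h
  have h01 := congrArg (fun M => M 0 1) h
  have h10 := congrArg (fun M => M 1 0) h
  have h11 := congrArg (fun M => M 1 1) h
  fin_cases i <;> fin_cases j <;>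
    simp [heckeMat, Matrix.adjugate_fin_two] at h00 h01 h10 h11 ⊢
  · exact two_mul_ne_one (N 0 1) (by linear_combination -h01 - h00)
  · exact two_mul_ne_one (N 0 0) (by linear_combination -h00)
  · exact two_mul_ne_one (-N 0 1) (by linear_combination h01)
  · exact two_mul_ne_one (N 0 0) (by linear_combination -h00)
  · exact two_mul_ne_one (N 1 1) (by linear_combination -h11)
  · exact two_mul_ne_one (N 1 1) (by linear_combination -h11 - h10)

/-- An equality `β k = k' adj(α)` of matrices over `ℤ₂`, read in `G`. -/
lemma heckeG_eq_adj {i j : Fin 3} {k k' : K}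
    (h : heckeMat i * k = (k' : Matrix (Fin 2) (Fin 2) ℤ_[2]) * (heckeMat j).adjugate) :
    heckeG i * incl k * heckeG j = incl k' * two := by
  apply Units.ext
  have h1 : heckeMat i * k * heckeMat j =
      (k' : Matrix (Fin 2) (Fin 2) ℤ_[2]) * Matrix.scalar (Fin 2) (2 : ℤ_[2]) := by
    rw [h, mul_assoc, Matrix.adjugate_mul, det_heckeMat, Matrix.smul_one_eq_diagonal]
    rfl
  have h2 := congrArg (algebraMap ℤ_[2] ℚ_[2]).mapMatrix h1
  simp only [map_mul] at h2
  have h3 : (algebraMap ℤ_[2] ℚ_[2]).mapMatrix (Matrix.scalar (Fin 2) (2 : ℤ_[2])) =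
      Matrix.scalar (Fin 2) (2 : ℚ_[2]) := by
    ext a b
    fin_cases a <;> fin_cases b <;> simp <;> rfl
  rw [h3] at h2
  exact h2

lemma det_heckeG (i : Fin 3) : ‖(heckeG i : Matrix (Fin 2) (Fin 2) ℚ_[2]).det‖ = 2⁻¹ := by
  rw [coe_heckeG, ← RingHom.map_det, det_heckeMat, map_ofNat]
  have : (2 : ℚ_[2]) = ((2 : ℕ) : ℚ_[2]) := by norm_num
  rw [this, Padic.norm_p]
  norm_num

lemma heckeG_row_unique {i j : Fin 3} {k k' : K} {n m : ℤ}
    (h : heckeG i * (incl k * two ^ n) = heckeG j * (incl k' * two ^ m)) : i = j := by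
  have h1 := congrArg (fun g : G => ‖(g : Matrix (Fin 2) (Fin 2) ℚ_[2]).det‖) h
  simp only [Matrix.GeneralLinearGroup.coe_mul, Matrix.det_mul, norm_mul, norm_det_incl, one_mul,
    norm_det_two_zpow, det_heckeG] at h1
  have h2 : n = m := zpow_right_injective₀ (by norm_num) (by norm_num)
    (mul_left_cancel₀ (by norm_num) h1)
  subst h2
  rw [← mul_assoc, ← mul_assoc] at h
  have h3 := mul_right_cancel h
  have h4 : heckeG i = heckeG j * incl (k' * k⁻¹) := by
    rw [map_mul, ← mul_assoc, ← h3, map_inv, mul_inv_cancel_right]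
  have h5 := congrArg (fun g : G => (g : Matrix (Fin 2) (Fin 2) ℚ_[2])) h4
  simp only [Matrix.GeneralLinearGroup.coe_mul, coe_heckeG, coe_incl] at h5
  rw [← map_mul] at h5
  exact row_unique (mapMatrix_injective h5)

lemma heckeG_col_unique {i j : Fin 3} {k k' : K} {n m : ℤ}
    (h : incl k * two ^ n * (heckeG i)⁻¹ = incl k' * two ^ m * (heckeG j)⁻¹) : i = j := by
  have h0 : heckeG i * (incl k⁻¹ * two ^ (-n)) = heckeG j * (incl k'⁻¹ * two ^ (-m)) := by
    have := congrArg (fun g => g⁻¹) h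
    simp only [mul_inv_rev, inv_inv, ← zpow_neg, ← map_inv] at this
    rwa [zpow_two_comm, zpow_two_comm] at this
  exact heckeG_row_unique h0

lemma exists_swap (k : K) (i : Fin 3) :
    ∃ (j : Fin 3) (k' : K), (k : Matrix (Fin 2) (Fin 2) ℤ_[2]) * heckeMat i = heckeMat j * k' := by
  refine exists_row _ (u := (k : Matrix (Fin 2) (Fin 2) ℤ_[2]).det)
    ((Matrix.isUnit_iff_isUnit_det _).1 k.isUnit) ?_
  rw [Matrix.det_mul, det_heckeMat, mul_comm]

lemma incl_mul_heckeG {k k' : K} {i j : Fin 3}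
    (h : (k : Matrix (Fin 2) (Fin 2) ℤ_[2]) * heckeMat i = heckeMat j * k') :
    incl k * heckeG i = heckeG j * incl k' := by
  apply Units.ext
  have := congrArg (algebraMap ℤ_[2] ℚ_[2]).mapMatrix h
  simp only [map_mul] at this
  exact this

section

variable (R : Type*) [CommRing R] [Algebra ℤ_[2] R]

/-- The Hecke operator `T`, as a `G`-equivariant operator on functions on `G`:
`(T f) (x) = ∑ β · f (β⁻¹ x)`, the sum over the representatives `β` of the cosets in
`K (2 0; 0 1) K / K`. On elementary functions this is the usual formula
`T [g, v] = ∑ [g α, adj(α) · v]`, see `hecke_elem`. -/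
def hecke : (G → Poly R) →ₗ[R] (G → Poly R) where
  toFun f x := ∑ i, act R (heckeMat i) (f ((heckeG i)⁻¹ * x))
  map_add' f g := by
    ext1 x
    simp [Finset.sum_add_distrib]
  map_smul' c f := by
    ext1 x
    simp [Finset.smul_sum]

variable {R}

lemma hecke_apply (f : G → Poly R) (x : G) :
    hecke R f x = ∑ i, act R (heckeMat i) (f ((heckeG i)⁻¹ * x)) := rfl

lemma hecke_translation (g : G) (f : G → Poly R) :
    hecke R (translation R g f) = translation R g (hecke R f) := by
  ext1 x
  simp only [hecke_apply, translation_apply, mul_assoc]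

/-- `T [g, v] = ∑ [g α, adj(α) · v]` over `α = (2 μ; 0 1)`, `μ = 0, 1`, and `α = (1 0; 0 2)`;
here `adj (2 μ; 0 1) · v = v (X, 2 Y - μ X)` and `adj (1 0; 0 2) · v = v (2 X, Y)`. -/
theorem hecke_elem (g : G) (v : Poly R) :
    hecke R (elem g v) = ∑ i, elem (g * heckeG i) (act R (heckeMat i).adjugate v) := by
  classical
  ext1 x
  rw [hecke_apply, Finset.sum_apply]
  by_cases hA : ∃ i, (heckeG i)⁻¹ * x * g ∈ KZ
  · obtain ⟨i, k, n, hi⟩ := hA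
    have hy : x * g = heckeG i * (incl k * two ^ n) := by
      rw [← hi]; group
    obtain ⟨j, k', hj⟩ := exists_col (heckeMat i * k)
      (u := (k : Matrix (Fin 2) (Fin 2) ℤ_[2]).det)
      ((Matrix.isUnit_iff_isUnit_det _).1 k.isUnit) (by rw [Matrix.det_mul, det_heckeMat])
    have hy' : x * (g * heckeG j) = incl k' * two ^ (n + 1) := by
      rw [← mul_assoc, hy, ← mul_assoc, mul_assoc _ _ (heckeG j), zpow_two_comm, ← mul_assoc,
        heckeG_eq_adj hj, mul_assoc, ← zpow_one_add, add_comm]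
    rw [Finset.sum_eq_single i, Finset.sum_eq_single j]
    · rw [elem, if_pos (by rw [hi]; exact ⟨k, n, rfl⟩), elem,
        if_pos (by rw [hy']; exact ⟨k', n + 1, rfl⟩), hi, hy', kpart_eq, kpart_eq, ← act_mul,
        ← act_mul, hj]
    · intro j' _ hne
      rw [elem, if_neg]
      rintro ⟨k2, m, h2⟩
      refine hne (heckeG_col_unique (k := k2) (k' := k') (n := m) (m := n + 1) ?_)
      rw [← h2, ← hy']; group
    · simp
    · intro i' _ hne
      rw [elem, if_neg, map_zero]
      rintro ⟨k2, m, h2⟩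
      refine hne (heckeG_row_unique (k := k2) (k' := k) (n := m) (m := n) ?_)
      rw [← h2, ← hi]; group
    · simp
  · rw [Finset.sum_eq_zero, Finset.sum_eq_zero]
    · intro j _
      rw [elem, if_neg]
      rintro ⟨k, n, h⟩
      obtain ⟨i, k', h'⟩ := exists_row ((k : Matrix (Fin 2) (Fin 2) ℤ_[2]) * (heckeMat j).adjugate)
        (u := (k : Matrix (Fin 2) (Fin 2) ℤ_[2]).det)
        ((Matrix.isUnit_iff_isUnit_det _).1 k.isUnit) (by
          rw [Matrix.det_mul, Matrix.det_adjugate, det_heckeMat]; simp [mul_comm])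
      have h3 := heckeG_eq_adj h'.symm
      refine hA ⟨i, k', n - 1, ?_⟩
      have h4 : x * g = incl k * two ^ n * (heckeG j)⁻¹ := by rw [← h]; group
      have h5 : incl k = heckeG i * incl k' * heckeG j * two⁻¹ := by rw [h3]; group
      have h6 : two⁻¹ * two ^ n = two ^ (n - 1) := by
        rw [← zpow_neg_one, ← zpow_add]; congr 1; ring
      calc (heckeG i)⁻¹ * x * g = (heckeG i)⁻¹ * (x * g) := mul_assoc _ _ _
        _ = incl k' * (heckeG j * (two⁻¹ * two ^ n)) * (heckeG j)⁻¹ := by rw [h4, h5]; group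
        _ = incl k' * two ^ (n - 1) := by rw [h6, ← zpow_two_comm]; group
    · intro i _
      rw [elem, if_neg (fun h => hA ⟨i, h⟩), map_zero]

/-- `T` preserves `𝓘(Sym^r R²)`. -/
lemma hecke_mem {r : ℕ} {f : G → Poly R} (hf : f ∈ (cInd (Sym R r)).toSubmodule) :
    hecke R f ∈ (cInd (Sym R r)).toSubmodule := by
  classical
  have hK : ∀ (k : K) (x : G), hecke R f (incl k * x) = act R k (hecke R f x) := by
    intro k x
    choose σ κ hσ using exists_swap k
    have hinj : Function.Injective σ := by
      intro i j hij
      have h1 : heckeMat i = ((k⁻¹ : K) : Matrix (Fin 2) (Fin 2) ℤ_[2]) * (heckeMat (σ i) * κ i) := by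
        rw [← hσ, ← mul_assoc, ← Matrix.GeneralLinearGroup.coe_mul, inv_mul_cancel,
          Matrix.GeneralLinearGroup.coe_one, one_mul]
      have h2 : heckeMat (σ j) = (k : Matrix (Fin 2) (Fin 2) ℤ_[2]) * heckeMat j *
          ((κ j)⁻¹ : K) := by
        rw [hσ, mul_assoc, ← Matrix.GeneralLinearGroup.coe_mul, mul_inv_cancel,
          Matrix.GeneralLinearGroup.coe_one, mul_one]
      rw [hij, h2] at h1
      refine row_unique (N := ((κ j)⁻¹ : K) * (κ i : Matrix (Fin 2) (Fin 2) ℤ_[2])) ?_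
      rw [h1]
      simp only [← mul_assoc]
      rw [← Matrix.GeneralLinearGroup.coe_mul, inv_mul_cancel,
          Matrix.GeneralLinearGroup.coe_one, one_mul]
    have hbij : Function.Bijective σ := Finite.injective_iff_bijective.1 hinj
    rw [hecke_apply, hecke_apply, map_sum]
    symm
    refine Fintype.sum_bijective σ hbij _ _ (fun i => ?_)
    have h1 := incl_mul_heckeG (hσ i)
    have h2 : (heckeG (σ i))⁻¹ * (incl k * x) = incl (κ i) * ((heckeG i)⁻¹ * x) := by
      have : incl k = heckeG (σ i) * incl (κ i) * (heckeG i)⁻¹ := by rw [← h1]; group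
      rw [this]; group
    rw [h2, hf.2.1, ← act_mul, ← act_mul, hσ]
  have hf' := mem_cInd.1 hf
  obtain ⟨S, hS⟩ := hf'.2.2.2
  refine ⟨fun x => Submodule.sum_mem _ fun i _ => act_mem_Sym _ (hf'.1 _), hK, fun x => ?_, ?_⟩
  · rw [hecke_apply, hecke_apply]
    refine Finset.sum_congr rfl fun i _ => ?_
    rw [← mul_assoc, ← two_comm, mul_assoc, hf'.2.2.1]
  · refine ⟨(Finset.univ ×ˢ S).image (fun p : Fin 3 × G => (heckeG p.1)⁻¹ * p.2), fun x hx => ?_⟩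
    rw [hecke_apply] at hx
    obtain ⟨i, -, hi⟩ := Finset.exists_ne_zero_of_sum_ne_zero hx
    obtain ⟨s, hs, k, n, h⟩ := hS _ (fun h0 => hi (by rw [h0, map_zero]))
    obtain ⟨j, k', hj⟩ := exists_col (heckeMat i * k)
      (u := (k : Matrix (Fin 2) (Fin 2) ℤ_[2]).det)
      ((Matrix.isUnit_iff_isUnit_det _).1 k.isUnit) (by rw [Matrix.det_mul, det_heckeMat])
    refine ⟨(heckeG j)⁻¹ * s, Finset.mem_image.2 ⟨(j, s), by simp [hs], rfl⟩, k', n + 1, ?_⟩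
    have h3 := heckeG_eq_adj hj
    have h4 : x = heckeG i * incl k * two ^ n * s := by
      rw [mul_assoc _ _ (two ^ n), ← h]; group
    rw [h4, mul_inv_rev, inv_inv, zpow_add, zpow_one, zpow_two_comm n two, ← mul_assoc (incl k'),
      ← h3, mul_assoc _ (two ^ n) s, mul_assoc _ _ (two ^ n), ← zpow_two_comm n (heckeG j)]
    group

end

/-! ### Subquotients of representations -/

section Subquotient

variable {A H V : Type*} [CommRing A] [Monoid H] [AddCommGroup V] [Module A V]
  {ρ : Representation A H V}

/-- For subrepresentations `M`, `N`, the space `M / (M ∩ N)`. -/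
abbrev SubQuot (M N : Subrepresentation ρ) : Type _ :=
  M.toSubmodule ⧸ N.toSubmodule.submoduleOf M.toSubmodule

/-- For subrepresentations `M`, `N`, the representation on `M / (M ∩ N)`. -/
def subQuotRep (M N : Subrepresentation ρ) : Representation A H (SubQuot M N) :=
  M.toRepresentation.quotient (N.toSubmodule.submoduleOf M.toSubmodule)
    (fun g _ hx => N.apply_mem_toSubmodule g hx)

end Subquotient

/-! ### `ℚ̄₂`, `ℤ̄₂`, `𝔽̄₂` -/

/-- `ℚ̄₂`, with the absolute value extending the one of `ℚ₂`. -/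
abbrev QBar := PadicAlgCl 2

/-- The valuation ring `ℤ̄₂` of `ℚ̄₂`. -/
abbrev ZBar := (Valued.v : Valuation QBar NNReal).valuationSubring

/-- The residue field `𝔽̄₂` of `ℤ̄₂`. -/
abbrev FBar := IsLocalRing.ResidueField ZBar

lemma mem_ZBar {x : QBar} : x ∈ ZBar ↔ ‖x‖ ≤ 1 := Iff.rfl

instance : Algebra ℤ_[2] ZBar :=
  ((algebraMap ℤ_[2] QBar).codRestrict ZBar.toSubring (fun x => by
    change ‖algebraMap ℤ_[2] QBar x‖ ≤ 1
    rw [IsScalarTower.algebraMap_apply ℤ_[2] ℚ_[2] QBar]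
    have h := PadicAlgCl.norm_extends 2 (x : ℚ_[2])
    have h2 := x.2
    exact h.trans_le h2)).toAlgebra

instance : IsScalarTower ℤ_[2] ZBar QBar := IsScalarTower.of_algebraMap_eq (fun _ => rfl)

lemma two_eq_zero : (2 : FBar) = 0 := by
  have h : (2 : ZBar) ∈ IsLocalRing.maximalIdeal ZBar := by
    rw [IsLocalRing.mem_maximalIdeal, mem_nonunits_iff]
    intro hu
    obtain ⟨y, hy⟩ := hu.exists_right_inv
    have h1 := congrArg (fun z : ZBar => ‖(z : QBar)‖) hy
    have h2 : ‖(2 : QBar)‖ = 2⁻¹ := by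
      have h := PadicAlgCl.norm_extends 2 ((2 : ℕ) : ℚ_[2])
      rw [Padic.norm_p, map_natCast] at h
      exact_mod_cast h
    have h3 : ‖(y : QBar)‖ ≤ 1 := y.2
    simp only [MulMemClass.coe_mul, norm_mul, OneMemClass.coe_one, norm_one] at h1
    have h4 : ((2 : ZBar) : QBar) = 2 := rfl
    rw [h4, h2] at h1
    linarith
  have h := (IsLocalRing.residue_eq_zero_iff (2 : ZBar)).2 h
  rwa [map_ofNat] at h

/-! ### The representations `π(r, c, 1)` -/

section

variable (R : Type*) [CommRing R] [Algebra ℤ_[2] R]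

/-- The image `(T - c) 𝓘(Sym^r R²)`. -/
def heckeImage (r : ℕ) (c : R) : Subrepresentation (translation R) where
  toSubmodule := (cInd (Sym R r)).toSubmodule.map (hecke R - c • LinearMap.id)
  apply_mem_toSubmodule := by
    rintro g _ ⟨f, hf, rfl⟩
    refine ⟨translation R g f, (cInd (Sym R r)).apply_mem_toSubmodule g hf, ?_⟩
    simp [hecke_translation]

lemma heckeImage_le (r : ℕ) (c : R) :
    (heckeImage R r c).toSubmodule ≤ (cInd (Sym R r)).toSubmodule := by
  rintro _ ⟨f, hf, rfl⟩
  exact Submodule.sub_mem _ (hecke_mem hf) (Submodule.smul_mem _ c hf)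

end

/-- `V_r = Sym^r 𝔽̄₂²`. -/
abbrev V (r : ℕ) : Submodule FBar (Poly FBar) := Sym FBar r

/-- The space of `π(r, c, 1) = 𝓘(V_r) / (T - c) 𝓘(V_r)`. -/
abbrev Pi (r : ℕ) (c : FBar) : Type := SubQuot (cInd (V r)) (heckeImage FBar r c)

/-- The representation `π(r, c, 1) = 𝓘(V_r) / (T - c) 𝓘(V_r)` of `G` over `𝔽̄₂`. -/
def piRep (r : ℕ) (c : FBar) : Representation FBar G (Pi r c) :=
  subQuotRep (cInd (V r)) (heckeImage FBar r c)

/-! ### The lattice `Θ` and its reduction -/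

/-- The coefficientwise map on functions `G → ℤ̄₂[X, Y]` induced by `ℤ̄₂ → R'`. -/
def coeffMap (R' : Type*) [CommRing R'] [Algebra ZBar R'] :
    (G → Poly ZBar) →ₗ[ZBar] (G → Poly R') :=
  LinearMap.compLeft (MvPolynomial.mapAlgHom (Algebra.ofId ZBar R')).toLinearMap G

lemma coeffMap_apply (R' : Type*) [CommRing R'] [Algebra ZBar R'] (f : G → Poly ZBar) (x : G) :
    coeffMap R' f x = MvPolynomial.map (algebraMap ZBar R') (f x) := rfl

/-- The part of `𝓘(Sym^r ℤ̄₂²)` that lies in `(T - a) 𝓘(Sym^r ℚ̄₂²)`. -/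
def latticeRel (a : QBar) (r : ℕ) : Subrepresentation (translation ZBar) where
  toSubmodule := (cInd (Sym ZBar r)).toSubmodule ⊓
    ((heckeImage QBar r a).toSubmodule.restrictScalars ZBar).comap (coeffMap QBar)
  apply_mem_toSubmodule := by
    rintro g f ⟨h1, h2⟩
    exact ⟨(cInd (Sym ZBar r)).apply_mem_toSubmodule g h1,
      (heckeImage QBar r a).apply_mem_toSubmodule g h2⟩

/-- `Θ_{k,a}`, with `k = r + 2`: the quotient of `𝓘(Sym^r ℤ̄₂²)` by
`(T - a) 𝓘(Sym^r ℚ̄₂²) ∩ 𝓘(Sym^r ℤ̄₂²)`, i.e. the image of `𝓘(Sym^r ℤ̄₂²)` in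
`𝓘(Sym^r ℚ̄₂²) / (T - a)`. -/
abbrev Theta (a : QBar) (r : ℕ) : Type := SubQuot (cInd (Sym ZBar r)) (latticeRel a r)

/-- The action of `G` on `Θ_{k,a}`. -/
def thetaRep (a : QBar) (r : ℕ) : Representation ZBar G (Theta a r) :=
  subQuotRep (cInd (Sym ZBar r)) (latticeRel a r)

/-- The class in `Θ_{k,a}` of an element of `𝓘(Sym^r ℤ̄₂²)`. -/
def toTheta (a : QBar) (r : ℕ) : (cInd (Sym ZBar r)).toSubmodule →ₗ[ZBar] Theta a r :=
  Submodule.mkQ _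

lemma thetaRep_toTheta (a : QBar) (r : ℕ) (g : G) (F : (cInd (Sym ZBar r)).toSubmodule) :
    thetaRep a r g (toTheta a r F) = toTheta a r ((cInd (Sym ZBar r)).toRepresentation g F) := rfl

/-- The reduction `Θ̄_{k,a} = 𝔽̄₂ ⊗ Θ_{k,a}`. -/
abbrev ThetaBar (a : QBar) (r : ℕ) : Type := FBar ⊗[ZBar] Theta a r

/-- The action of `G` on `Θ̄_{k,a}`. -/
def thetaBarRep (a : QBar) (r : ℕ) : Representation FBar G (ThetaBar a r) where
  toFun g := (thetaRep a r g).baseChange FBar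
  map_one' := by rw [map_one]; exact LinearMap.baseChange_id
  map_mul' g h := by rw [map_mul]; exact LinearMap.baseChange_comp _ _

/-! ### The natural map `P : 𝓘(V_r) → Θ̄` -/

lemma map_act {R R' : Type*} [CommRing R] [CommRing R'] [Algebra ℤ_[2] R] [Algebra ℤ_[2] R']
    [Algebra R R'] [IsScalarTower ℤ_[2] R R'] (M : Matrix (Fin 2) (Fin 2) ℤ_[2]) (f : Poly R) :
    MvPolynomial.map (algebraMap R R') (act R M f) =
      act R' M (MvPolynomial.map (algebraMap R R') f) := by
  induction f using MvPolynomial.induction_on with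
  | C c => simp
  | add p q hp hq => simp [hp, hq]
  | mul_X p i hp =>
    simp only [map_mul, hp, act_X, MvPolynomial.map_X, map_sum, MvPolynomial.map_C,
      ← IsScalarTower.algebraMap_apply]

lemma map_mem_Sym {R R' : Type*} [CommRing R] [CommRing R'] (φ : R →+* R') {r : ℕ} {f : Poly R}
    (hf : f ∈ Sym R r) : MvPolynomial.map φ f ∈ Sym R' r :=
  MvPolynomial.IsHomogeneous.map hf φ

/-- Reduction of coefficients `𝓘(Sym^r ℤ̄₂²) → 𝓘(V_r)`. -/
def red (r : ℕ) (F : (cInd (Sym ZBar r)).toSubmodule) : (cInd (V r)).toSubmodule :=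
  ⟨coeffMap FBar F.1, by
    obtain ⟨f, hf⟩ := F
    obtain ⟨h1, h2, h3, S, hS⟩ := mem_cInd.1 hf
    refine ⟨fun x => map_mem_Sym _ (h1 x), fun k x => ?_, fun x => ?_, S, fun x hx => hS x ?_⟩
    · change MvPolynomial.map _ (f _) = act _ _ (MvPolynomial.map _ (f x))
      rw [h2]
      exact map_act _ _
    · change MvPolynomial.map _ (f _) = MvPolynomial.map _ (f x)
      rw [h3]
    · intro h
      refine hx ?_
      change MvPolynomial.map _ (f x) = 0
      rw [h, map_zero]⟩

lemma red_apply (r : ℕ) (F : (cInd (Sym ZBar r)).toSubmodule) (x : G) :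
    (red r F).1 x = MvPolynomial.map (algebraMap ZBar FBar) (F.1 x) := rfl

lemma red_translation (r : ℕ) (g : G) (F : (cInd (Sym ZBar r)).toSubmodule) :
    red r ((cInd (Sym ZBar r)).toRepresentation g F) = (cInd (V r)).toRepresentation g (red r F) :=
  rfl

lemma exists_lift_poly {r : ℕ} {f : Poly FBar} (hf : f ∈ V r) :
    ∃ F ∈ Sym ZBar r, MvPolynomial.map (algebraMap ZBar FBar) F = f := by
  obtain ⟨F, hF⟩ := MvPolynomial.map_surjective (algebraMap ZBar FBar)
    IsLocalRing.residue_surjective f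
  refine ⟨homogeneousComponent r F, homogeneousComponent_mem _ _, ?_⟩
  ext d
  rw [coeff_map, coeff_homogeneousComponent]
  split_ifs with h
  · rw [← hF, coeff_map]
  · rw [map_zero]
    by_contra h'
    refine h ?_
    have := (mem_homogeneousSubmodule _ _).1 hf (Ne.symm h')
    rw [Finsupp.degree_eq_weight_one]
    exact this

lemma red_surjective (r : ℕ) : Function.Surjective (red r) := by
  classical
  rintro ⟨f, hf⟩
  obtain ⟨h1, h2, h3, S, hS⟩ := mem_cInd.1 hf
  have hL : ∀ x, ∃ F ∈ Sym ZBar r, MvPolynomial.map (algebraMap ZBar FBar) F = f x ∧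
      (f x = 0 → F = 0) := by
    intro x
    by_cases h : f x = 0
    · exact ⟨0, Submodule.zero_mem _, by simp [h], fun _ => rfl⟩
    · obtain ⟨F, hF, hF2⟩ := exists_lift_poly (h1 x)
      exact ⟨F, hF, hF2, fun h' => absurd h' h⟩
  choose L hL1 hL2 hL3 using hL
  let rep : G → G := fun x => (Quotient.mk (QuotientGroup.rightRel KZ) x).out
  have hrep : ∀ x, x * (rep x)⁻¹ ∈ KZ := fun x =>
    QuotientGroup.rightRel_apply.1 (Quotient.mk_out (s := QuotientGroup.rightRel KZ) x)
  have hrep2 : ∀ (h : G), h ∈ KZ → ∀ x, rep (h * x) = rep x := by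
    intro h hh x
    have : Quotient.mk (QuotientGroup.rightRel KZ) (h * x) = Quotient.mk _ x :=
      Quotient.sound (QuotientGroup.rightRel_apply.2 (by simpa using KZ.inv_mem hh))
    change Quotient.out _ = Quotient.out _
    rw [this]
  refine ⟨⟨fun x => act ZBar (kpart (x * (rep x)⁻¹)) (L (rep x)), fun x => act_mem_Sym _ (hL1 _),
    fun k x => ?_, fun x => ?_, S, fun x hx => hS x fun h0 => hx ?_⟩, ?_⟩
  · beta_reduce
    rw [hrep2 _ (incl_mem k), mul_assoc, kpart_incl_mul k (hrep x),
      Matrix.GeneralLinearGroup.coe_mul, act_mul]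
  · beta_reduce
    rw [hrep2 _ two_mem, mul_assoc, kpart_two_mul (hrep x)]
  · have h5 : f (rep x) = 0 := by
      have h6 := apply_KZ hf (KZ.inv_mem (hrep x)) x
      rw [h0, map_zero] at h6
      rw [← h6]; congr 1; group
    simp only [hL3 _ h5, map_zero]
  · apply Subtype.ext
    funext x
    rw [red_apply, map_act, hL2, ← apply_KZ hf (hrep x)]
    congr 1; group

lemma red_eq_zero {r : ℕ} {F : (cInd (Sym ZBar r)).toSubmodule} (h : red r F = 0) :
    ∃ c ∈ IsLocalRing.maximalIdeal ZBar, ∃ F' : (cInd (Sym ZBar r)).toSubmodule, F = c • F' := by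
  classical
  obtain ⟨f, hf⟩ := F
  obtain ⟨h1, h2, h3, S, hS⟩ := mem_cInd.1 hf
  have h0 : ∀ x, MvPolynomial.map (algebraMap ZBar FBar) (f x) = 0 := fun x =>
    congrFun (congrArg Subtype.val h) x
  let T : Finset ZBar := S.biUnion fun s => (f s).support.image fun d => (f s).coeff d
  have hT : ∀ c ∈ T, c ∈ IsLocalRing.maximalIdeal ZBar := by
    intro c hc
    simp only [T, Finset.mem_biUnion, Finset.mem_image] at hc
    obtain ⟨s, -, d, -, rfl⟩ := hc
    have h4 := congrArg (MvPolynomial.coeff d) (h0 s)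
    rw [coeff_map, coeff_zero] at h4
    exact (IsLocalRing.residue_eq_zero_iff _).1 h4
  obtain ⟨c, hc⟩ : ∃ c, Ideal.span (T : Set ZBar) = Ideal.span {c} :=
    (IsBezout.isPrincipal_of_FG _ ⟨T, rfl⟩).principal
  have hcm : c ∈ IsLocalRing.maximalIdeal ZBar := by
    have : Ideal.span (T : Set ZBar) ≤ IsLocalRing.maximalIdeal ZBar := Ideal.span_le.2 hT
    exact this (hc ▸ Ideal.mem_span_singleton_self c)
  have hdvdS : ∀ s ∈ S, C c ∣ f s := by
    intro s hs
    rw [C_dvd_iff_dvd_coeff]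
    intro d
    by_cases hd : (f s).coeff d = 0
    · rw [hd]; exact dvd_zero _
    · rw [← Ideal.mem_span_singleton, ← hc]
      refine Ideal.subset_span ?_
      simp only [T, Finset.coe_biUnion, Set.mem_iUnion, Finset.coe_image]
      exact ⟨s, hs, d, by simpa using hd, rfl⟩
  have hdvd : ∀ x, C c ∣ f x := by
    intro x
    by_cases hx : f x = 0
    · rw [hx]; exact dvd_zero _
    · obtain ⟨s, hs, hxs⟩ := hS x hx
      have h4 : f x = act ZBar (kpart (x * s⁻¹)) (f s) := by
        rw [← apply_KZ hf hxs]; congr 1; group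
      obtain ⟨q, hq⟩ := hdvdS s hs
      rw [h4, hq, map_mul, act_C]
      exact dvd_mul_right _ _
  refine ⟨c, hcm, ?_⟩
  by_cases hc0 : c = 0
  · refine ⟨0, Subtype.ext (funext fun x => ?_)⟩
    obtain ⟨q, hq⟩ := hdvd x
    simp [hq, hc0]
  have hC0 : (C c : Poly ZBar) ≠ 0 := by simpa using hc0
  choose q hq using hdvd
  refine ⟨⟨q, fun x => ?_, fun k x => ?_, fun x => ?_, S, fun x hx => hS x ?_⟩, ?_⟩
  · intro d hd
    refine h1 x (d := d) ?_
    rw [hq, coeff_C_mul]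
    exact mul_ne_zero hc0 hd
  · apply mul_left_cancel₀ hC0
    rw [← hq, h2, hq, map_mul, act_C]
  · apply mul_left_cancel₀ hC0
    rw [← hq, h3, hq]
  · rw [hq]; exact mul_ne_zero hC0 hx
  · refine Subtype.ext (funext fun x => ?_)
    change f x = c • q x
    rw [hq, MvPolynomial.smul_eq_C_mul]

/-- The class of an element of `𝓘(Sym^r ℤ̄₂²)` in `Θ̄_{k,a}`. -/
def toThetaBar (a : QBar) (r : ℕ) :
    (cInd (Sym ZBar r)).toSubmodule →ₗ[ZBar] ThetaBar a r :=
  TensorProduct.mk ZBar FBar (Theta a r) 1 ∘ₗ toTheta a r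

lemma toThetaBar_eq_zero {a : QBar} {r : ℕ} {F : (cInd (Sym ZBar r)).toSubmodule}
    (h : red r F = 0) : toThetaBar a r F = 0 := by
  obtain ⟨c, hc, F', rfl⟩ := red_eq_zero h
  have h1 : algebraMap ZBar FBar c = 0 := (IsLocalRing.residue_eq_zero_iff c).2 hc
  rw [map_smul]
  change c • ((1 : FBar) ⊗ₜ[ZBar] toTheta a r F') = 0
  rw [TensorProduct.smul_tmul', Algebra.smul_def, h1, zero_mul, TensorProduct.zero_tmul]

lemma toThetaBar_congr {a : QBar} {r : ℕ} {F F' : (cInd (Sym ZBar r)).toSubmodule}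
    (h : red r F = red r F') : toThetaBar a r F = toThetaBar a r F' := by
  rw [← sub_eq_zero, ← map_sub]
  refine toThetaBar_eq_zero (Subtype.ext ?_)
  have := congrArg Subtype.val h
  change coeffMap FBar (F.1 - F'.1) = 0
  rw [map_sub, sub_eq_zero]
  exact this

/-- The natural map `P : 𝓘(V_r) → Θ̄_{k,a}`: it sends the reduction of `F ∈ 𝓘(Sym^r ℤ̄₂²)` to the
class of `F`, see `P_red`. -/
def P (a : QBar) (r : ℕ) : (cInd (V r)).toSubmodule →ₗ[FBar] ThetaBar a r where
  toFun f := toThetaBar a r (red_surjective r f).choose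
  map_add' f g := by
    rw [← map_add]
    refine toThetaBar_congr ?_
    rw [(red_surjective r (f + g)).choose_spec]
    refine Subtype.ext ?_
    change _ = coeffMap FBar (_ + _)
    rw [map_add]
    exact congrArg₂ (· + ·) (congrArg Subtype.val (red_surjective r f).choose_spec).symm
      (congrArg Subtype.val (red_surjective r g).choose_spec).symm
  map_smul' c f := by
    obtain ⟨c, rfl⟩ := IsLocalRing.residue_surjective c
    have h : ∀ t : ThetaBar a r, (IsLocalRing.residue ZBar c) • t = c • t := fun t =>
      algebraMap_smul FBar c t
    rw [RingHom.id_apply, h, ← map_smul]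
    refine toThetaBar_congr ?_
    rw [(red_surjective r _).choose_spec]
    refine Subtype.ext ?_
    change _ = coeffMap FBar (c • _)
    rw [map_smul]
    have h2 := congrArg Subtype.val (red_surjective r f).choose_spec
    change coeffMap FBar _ = _ at h2
    rw [h2]
    funext x
    exact algebraMap_smul FBar c (f.1 x)

/-- The characterization of `P`. -/
lemma P_red (a : QBar) (r : ℕ) (F : (cInd (Sym ZBar r)).toSubmodule) :
    P a r (red r F) = (1 : FBar) ⊗ₜ[ZBar] toTheta a r F :=
  toThetaBar_congr (red_surjective r (red r F)).choose_spec

lemma P_translation (a : QBar) (r : ℕ) (g : G) (f : (cInd (V r)).toSubmodule) :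
    P a r ((cInd (V r)).toRepresentation g f) = thetaBarRep a r g (P a r f) := by
  obtain ⟨F, rfl⟩ := red_surjective r f
  rw [← red_translation, P_red, P_red]
  change _ = (thetaRep a r g).baseChange FBar _
  rw [LinearMap.baseChange_tmul, thetaRep_toTheta]

/-- The image `P(𝓘(W))` for a subspace `W` of `V_r`. -/
def imageP (a : QBar) (r : ℕ) (W : Submodule FBar (Poly FBar)) :
    Subrepresentation (thetaBarRep a r) where
  toSubmodule := ((cInd W).toSubmodule.submoduleOf (cInd (V r)).toSubmodule).map (P a r)
  apply_mem_toSubmodule := by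
    rintro g _ ⟨f, hf, rfl⟩
    exact ⟨(cInd (V r)).toRepresentation g f, (cInd W).apply_mem_toSubmodule g hf,
      P_translation a r g f⟩

/-! ### The filtration of `V_r` and the factor `𝓕'₃` -/

/-- `θ = X² Y - X Y²`. -/
def θ : Poly FBar := X 0 ^ 2 * X 1 - X 0 * X 1 ^ 2

/-- `V_r^{(n)} = θⁿ V_{r-3n}` if `3 n ≤ r`, and `0` otherwise. -/
def Vfil (r n : ℕ) : Submodule FBar (Poly FBar) :=
  if 3 * n ≤ r then (V (r - 3 * n)).map (LinearMap.mulLeft FBar (θ ^ n)) else ⊥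

/-- The preimage in `V_r^{(1)}` of the image of the injection `V_1 → V_r^{(1)} / V_r^{(2)}`,
`X ↦ θ X^{r-3}`, `Y ↦ θ Y^{r-3}`. -/
def Wone (r : ℕ) : Submodule FBar (Poly FBar) :=
  Vfil r 2 ⊔ Submodule.span FBar {θ * X 0 ^ (r - 3), θ * X 1 ^ (r - 3)}

/-- `Θ̄₀ = P(𝓘(V_r^{(1)}))`. -/
def Theta0 (a : QBar) (r : ℕ) : Subrepresentation (thetaBarRep a r) := imageP a r (Vfil r 1)

/-- `𝓕'₂ = P(𝓘(V_1))`, the image in `Θ̄₀` of the preimage of `𝓘(V_1)` in `𝓘(V_r^{(1)})`. -/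
def F2' (a : QBar) (r : ℕ) : Subrepresentation (thetaBarRep a r) := imageP a r (Wone r)

/-- The space of `𝓕'₃ = Θ̄₀ / 𝓕'₂`. -/
abbrev F3' (a : QBar) (r : ℕ) : Type := SubQuot (Theta0 a r) (F2' a r)

/-- The representation `𝓕'₃ = Θ̄₀ / 𝓕'₂` of `G` over `𝔽̄₂`. -/
def F3'Rep (a : QBar) (r : ℕ) : Representation FBar G (F3' a r) :=
  subQuotRep (Theta0 a r) (F2' a r)

/-! ### The maps `𝓘(V_r^{(1)}) → 𝓘(V_0)` and `𝓘(V_r^{(1)}) → 𝓕'₃` of the diagram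

They are written on `𝓘(V_n)`, `n = r - 3`, which is identified with `𝓘(V_r^{(1)})` through
multiplication by the invariant form `θ`. -/

lemma two_poly_eq_zero : (2 : Poly FBar) = 0 := by
  rw [← map_ofNat (C : FBar →+* Poly FBar), two_eq_zero, map_zero]

/-- A linear form on `V_n`: the sum of the coefficients of the monomials `X^{n-j} Y^j` with
`0 < j < n`. -/
def middle (n : ℕ) : Poly FBar →ₗ[FBar] FBar :=
  ∑ j ∈ Finset.Ioo 0 n, lcoeff FBar (Finsupp.single 0 (n - j) + Finsupp.single 1 j)

lemma middle_eq {n : ℕ} (hn : n ≠ 0) {f : Poly FBar} (hf : f ∈ V n) :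
    middle n f = eval ![1, 1] f + eval ![1, 0] f + eval ![0, 1] f := by
  classical
  have h2 : (1 : FBar) + 1 = 0 := by rw [one_add_one_eq_two, two_eq_zero]
  rw [f.as_sum]
  simp only [map_sum]
  rw [← Finset.sum_add_distrib, ← Finset.sum_add_distrib]
  refine Finset.sum_congr rfl fun d hd => ?_
  have hdeg : d 0 + d 1 = n := by
    have h := (mem_homogeneousSubmodule _ _).1 hf (mem_support_iff.1 hd)
    have h' := Finsupp.degree_eq_weight_one (R := ℕ) (σ := Fin 2)
    rw [show (1 : Fin 2 → ℕ) = fun _ => 1 from rfl] at h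
    rw [← show Finsupp.degree d = n by rw [h']; exact h, Finsupp.degree_eq_sum,
      Fin.sum_univ_two]
  have hmid : ∀ c : FBar, middle n (monomial d c) = if d 1 ∈ Finset.Ioo 0 n then c else 0 := by
    intro c
    rw [middle, LinearMap.sum_apply]
    simp only [lcoeff_apply, coeff_monomial]
    have : ∀ j ∈ Finset.Ioo 0 n,
        (if d = Finsupp.single 0 (n - j) + Finsupp.single 1 j then c else 0) =
        if d 1 = j then c else 0 := by
      intro j hj
      refine if_congr ⟨fun h => by rw [h]; simp, fun h => ?_⟩ rfl rfl
      ext i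
      fin_cases i
      · simp; omega
      · simpa using h
    rw [Finset.sum_congr rfl this, Finset.sum_ite_eq]
  rw [hmid]
  simp only [eval_monomial, Finsupp.prod_fintype, pow_zero, implies_true, Fin.prod_univ_two,
    Matrix.cons_val_zero, Matrix.cons_val_one, one_pow, mul_one, one_mul, Finset.mem_Ioo]
  generalize coeff d f = c
  have hcc : c + c = 0 := by linear_combination c * h2
  by_cases h0 : d 0 = 0
  · have h1 : d 1 ≠ 0 := by omega
    rw [if_neg (by omega), h0, zero_pow h1]
    simp [hcc]
  · by_cases h1 : d 1 = 0
    · rw [if_neg (by omega), h1, zero_pow h0]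
      simp [hcc]
    · rw [if_pos (by omega), zero_pow h0, zero_pow h1]
      simp

lemma bit (x : ℤ_[2]) : algebraMap ℤ_[2] FBar x = 0 ∨ algebraMap ℤ_[2] FBar x = 1 := by
  obtain ⟨y, rfl | rfl⟩ := even_or_odd x
  · left; rw [map_mul, map_ofNat, two_eq_zero, zero_mul]
  · right; rw [map_add, map_mul, map_ofNat, two_eq_zero, zero_mul, zero_add, map_one]

/-- The six reductions of elements of `K`. -/
lemma bits (k : K) : ∀ a b c d : FBar, a = algebraMap ℤ_[2] FBar (k.1 0 0) →
    b = algebraMap ℤ_[2] FBar (k.1 0 1) → c = algebraMap ℤ_[2] FBar (k.1 1 0) →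
    d = algebraMap ℤ_[2] FBar (k.1 1 1) →
    (a = 1 ∧ b = 0 ∧ c = 0 ∧ d = 1) ∨ (a = 0 ∧ b = 1 ∧ c = 1 ∧ d = 0) ∨
    (a = 1 ∧ b = 1 ∧ c = 0 ∧ d = 1) ∨ (a = 1 ∧ b = 0 ∧ c = 1 ∧ d = 1) ∨
    (a = 1 ∧ b = 1 ∧ c = 1 ∧ d = 0) ∨ (a = 0 ∧ b = 1 ∧ c = 1 ∧ d = 1) := by
  intro a b c d ha hb hc hd
  have hu : IsUnit (k.1.det) := (Matrix.isUnit_iff_isUnit_det _).1 k.isUnit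
  have h := hu.map (algebraMap ℤ_[2] FBar)
  rw [Matrix.det_fin_two, map_sub, map_mul, map_mul, ← ha, ← hb, ← hc, ← hd] at h
  have h0 := h.ne_zero
  have h1 : (1 : FBar) ≠ 0 := one_ne_zero
  rcases ha ▸ bit (k.1 0 0) with h2 | h2 <;> rcases hb ▸ bit (k.1 0 1) with h3 | h3 <;>
    rcases hc ▸ bit (k.1 1 0) with h4 | h4 <;> rcases hd ▸ bit (k.1 1 1) with h5 | h5 <;>
    simp [h2, h3, h4, h5] at h0 ⊢

lemma act_θ (k : K) : act FBar k θ = θ := by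
  have h2 := two_poly_eq_zero
  have h := bits k _ _ _ _ rfl rfl rfl rfl
  simp only [θ, map_sub, map_mul, map_pow, act_X, Fin.sum_univ_two]
  rcases h with ⟨ha, hb, hc, hd⟩ | ⟨ha, hb, hc, hd⟩ | ⟨ha, hb, hc, hd⟩ | ⟨ha, hb, hc, hd⟩ |
    ⟨ha, hb, hc, hd⟩ | ⟨ha, hb, hc, hd⟩ <;>
    simp only [ha, hb, hc, hd, C_1, C_0, one_mul, zero_mul, add_zero, zero_add]
  · linear_combination (X 1 ^ 2 * X 0 - X 0 ^ 2 * X 1) * h2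
  · linear_combination (-X 0 ^ 2 * X 1) * h2
  · linear_combination (X 0 * X 1 ^ 2) * h2
  · linear_combination (X 0 * X 1 ^ 2) * h2
  · linear_combination (-X 0 ^ 2 * X 1) * h2

lemma eval_act (M : Matrix (Fin 2) (Fin 2) ℤ_[2]) (v : Fin 2 → FBar) (f : Poly FBar) :
    eval v (act FBar M f) =
      eval (fun j => ∑ i, algebraMap ℤ_[2] FBar (M i j) * v i) f := by
  induction f using MvPolynomial.induction_on with
  | C c => simp
  | add p q hp hq => simp [hp, hq]
  | mul_X p i hp => simp [hp, act_X]

lemma middle_act (n : ℕ) (k : K) {f : Poly FBar} (hf : f ∈ V n) :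
    middle n (act FBar k f) = middle n f := by
  by_cases hn : n = 0
  · subst hn; simp [middle]
  rw [middle_eq hn hf, middle_eq hn (act_mem_Sym _ hf), eval_act, eval_act, eval_act]
  have h2 : (1 : FBar) + 1 = 0 := by rw [one_add_one_eq_two, two_eq_zero]
  have e : ∀ x y : FBar, (fun j => ∑ i, algebraMap ℤ_[2] FBar (k.1 i j) * (![x, y] : Fin 2 → FBar) i)
      = ![algebraMap ℤ_[2] FBar (k.1 0 0) * x + algebraMap ℤ_[2] FBar (k.1 1 0) * y,
        algebraMap ℤ_[2] FBar (k.1 0 1) * x + algebraMap ℤ_[2] FBar (k.1 1 1) * y] := by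
    intro x y
    funext j
    fin_cases j <;> simp [Fin.sum_univ_two]
  rw [e, e, e]
  have h := bits k _ _ _ _ rfl rfl rfl rfl
  rcases h with ⟨ha, hb, hc, hd⟩ | ⟨ha, hb, hc, hd⟩ | ⟨ha, hb, hc, hd⟩ | ⟨ha, hb, hc, hd⟩ |
    ⟨ha, hb, hc, hd⟩ | ⟨ha, hb, hc, hd⟩ <;>
    simp only [ha, hb, hc, hd, mul_zero, mul_one, add_zero, zero_add, h2] <;>
    ring

/-- The map `𝓘(V_n) ≅ 𝓘(V_r^{(1)}) → 𝓘(V_0)`, `n = r - 3`, induced by the projection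
`V_r^{(1)} → V_0`, `θ X^{n-j} Y^j ↦ 1` if `0 < j < n`, and `↦ 0` otherwise. -/
def projI (n : ℕ) : (cInd (V n)).toSubmodule →ₗ[FBar] (cInd (V 0)).toSubmodule where
  toFun F := ⟨fun x => C (middle n (F.1 x)), by
    obtain ⟨f, hf⟩ := F
    obtain ⟨h1, h2, h3, S, hS⟩ := mem_cInd.1 hf
    refine ⟨fun x => (mem_homogeneousSubmodule _ _).2 (isHomogeneous_C _ _), fun k x => ?_,
      fun x => ?_, S, fun x hx => hS x fun h => hx ?_⟩
    · change C (middle n (f _)) = act _ _ (C (middle n (f x)))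
      rw [act_C, h2, middle_act n k (h1 x)]
    · change C (middle n (f _)) = C (middle n (f x))
      rw [h3]
    · change C (middle n (f x)) = 0
      rw [h, map_zero, map_zero]⟩
  map_add' F F' := Subtype.ext (funext fun x => by simp)
  map_smul' c F := Subtype.ext (funext fun x => by
    change C (middle n (c • F.1 x)) = c • C (middle n (F.1 x))
    rw [map_smul, smul_eq_mul, map_mul, MvPolynomial.smul_eq_C_mul])

lemma θ_mem : θ ∈ V 3 := by
  have h0 := isHomogeneous_X FBar (0 : Fin 2)
  have h1 := isHomogeneous_X FBar (1 : Fin 2)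
  exact (V 3).sub_mem ((mem_homogeneousSubmodule _ _).2 ((h0.pow 2).mul h1))
    ((mem_homogeneousSubmodule _ _).2 (h0.mul (h1.pow 2)))

lemma Vfil_one_le (r : ℕ) : Vfil r 1 ≤ V r := by
  unfold Vfil
  split_ifs with h
  · rintro _ ⟨f, hf, rfl⟩
    have := ((mem_homogeneousSubmodule _ _).1 θ_mem).mul ((mem_homogeneousSubmodule _ _).1 hf)
    rw [mem_homogeneousSubmodule]
    convert this using 1
    · simp
    · omega
  · exact bot_le

lemma θ_mul_mem {r : ℕ} (hr : 3 ≤ r) {F : G → Poly FBar}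
    (hF : F ∈ (cInd (V (r - 3))).toSubmodule) :
    (fun x => θ * F x) ∈ (cInd (Vfil r 1)).toSubmodule := by
  obtain ⟨h1, h2, h3, S, hS⟩ := mem_cInd.1 hF
  refine ⟨fun x => ?_, fun k x => ?_, fun x => ?_, S, fun x hx => hS x fun h => hx ?_⟩
  · rw [Vfil, if_pos (by omega)]
    exact ⟨F x, h1 x, by simp⟩
  · beta_reduce
    rw [h2, map_mul, act_θ]
  · beta_reduce
    rw [h3]
  · beta_reduce
    rw [h, mul_zero]

/-- Multiplication by `θ`, as a map `𝓘(V_{r-3}) → 𝓘(V_r)`; its image is `𝓘(V_r^{(1)})`. -/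
def θI (r : ℕ) (hr : 3 ≤ r) : (cInd (V (r - 3))).toSubmodule →ₗ[FBar] (cInd (V r)).toSubmodule where
  toFun F := ⟨fun x => θ * F.1 x, by
    have h := θ_mul_mem hr F.2
    exact ⟨fun x => Vfil_one_le _ (h.1 x), h.2⟩⟩
  map_add' F F' := Subtype.ext (funext fun x => by simp [mul_add])
  map_smul' c F := Subtype.ext (funext fun x => by simp)

/-- The map `𝓘(V_{r-3}) ≅ 𝓘(V_r^{(1)}) → Θ̄₀`, `F ↦ P(θ F)`. -/
def toTheta0 (a : QBar) (r : ℕ) (hr : 3 ≤ r) :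
    (cInd (V (r - 3))).toSubmodule →ₗ[FBar] (Theta0 a r).toSubmodule :=
  (P a r ∘ₗ θI r hr).codRestrict (Theta0 a r).toSubmodule
    (fun F => ⟨θI r hr F, θ_mul_mem hr F.2, rfl⟩)

/-- The composition `𝓘(V_{r-3}) ≅ 𝓘(V_r^{(1)}) → Θ̄₀ → 𝓕'₃`. -/
def toF3' (a : QBar) (r : ℕ) (hr : 3 ≤ r) : (cInd (V (r - 3))).toSubmodule →ₗ[FBar] F3' a r :=
  Submodule.mkQ _ ∘ₗ toTheta0 a r hr

/-- The class in `π(r, c, 1)` of an element of `𝓘(V_r)`. -/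
def toPi (r : ℕ) (c : FBar) : (cInd (V r)).toSubmodule →ₗ[FBar] Pi r c :=
  Submodule.mkQ _

/-- For `v(a) = v(2) = 1`, the residue class of the unit `a / 2` in `𝔽̄₂`. -/
def halfResidue (a : QBar) (ha : ‖a‖ = ‖(2 : QBar)‖) : FBar :=
  IsLocalRing.residue ZBar ⟨a / 2, by
    rw [mem_ZBar, norm_div, ha]
    exact div_self_le_one _⟩

end BT2

end

/-! Write r = 2S + 6 and a = 2α, and let λ ≠ 0 be the residue of α. The function [g, v] is thought
of as sitting at the vertex g K ℚ₂ˣ of the tree of `G`; the vertices g αᵢ, with αᵢ = `heckeG i`, are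
its three neighbours. All computations take place in Θ̄ / 𝓕'₂, which contains 𝓕'₃. There `cls g v`
is the class of P[g, v], and it vanishes for v ∈ W. Modulo W every form θu is a multiple of
θX^{r-4}Y, so only e(g) = `cls g (θX^{r-4}Y)` matters, and the claim is that ∑ᵢ e(g αᵢ) = λ e(g).

Relations arise from integral elements of the form d⁻¹(T - a)f with f integral (`toTheta_eq_zero`).
The auxiliary class is A(g) = `cls g (X^{r-1}Y)`, which equals the class of X^{r-2}Y² because
θX^{r-3} ∈ W. Three choices of f are used.

With d = 1 and f = [g α₁⁻¹, X^{r-1}Y], the class of X^r vanishes at every vertex (`cls_X_zero_pow`).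
With d = 2 and f = [g, X^{r-2}Y² - X^{r-3}Y³], one gets A(g α₁) = λ e(g) (`cls_heckeG_one`). Both A
and e are unchanged when g is multiplied on the right by `K` (`cls_mul_incl_eq`, `cls_θ_mul_incl`),
and for A this uses that r is even. As `K` permutes the neighbours transitively, A(h) = λ e(g)
whenever g and h are adjacent (`cls_mul_heckeG`, `cls_mul_heckeG_inv`).

With d = 4, f is a times X^{r-2}Y² at the three neighbours of g, plus a correcting form b at g
itself. This gives λ A(g) = λ² ∑ A(h) over the neighbours h of g (`cls_neighbours`). Each A(h) is λ
e(g) and 3 = 1 in characteristic 2, so A(g) = λ² e(g). On the other hand A(g) = λ e(g αᵢ) for each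
i. Summing over i and cancelling λ gives the claim (`sum_cls_θ`), and the factorization through π(0,
λ, 1) is then formal. -/

noncomputable section

namespace BT2

/-! ### Elementary functions -/

section Elementary

variable {R : Type*} [CommRing R] [Algebra ℤ_[2] R]

lemma elem_add (g : G) (v w : Poly R) : elem g (v + w) = elem g v + elem g w := by
  classical
  funext x
  by_cases h : x * g ∈ KZ <;> simp [elem, h]

lemma elem_smul (g : G) (c : R) (v : Poly R) : elem g (c • v) = c • elem g v := by
  classical
  funext x
  by_cases h : x * g ∈ KZ <;> simp [elem, h]

lemma kpart_mul_incl {h : G} (hh : h ∈ KZ) (k : K) : kpart (h * incl k) = kpart h * k := by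
  obtain ⟨k', n, rfl⟩ := hh
  rw [mul_assoc, zpow_two_comm, ← mul_assoc, ← map_mul, kpart_eq, kpart_eq]

lemma elem_mul_incl (g : G) (k : K) (v : Poly R) : elem (g * incl k) v = elem g (act R k v) := by
  classical
  funext x
  have h : x * (g * incl k) ∈ KZ ↔ x * g ∈ KZ := by
    rw [← mul_assoc]; exact KZ.mul_mem_cancel_right (incl_mem k)
  by_cases hx : x * g ∈ KZ
  · rw [elem, elem, if_pos (h.2 hx), if_pos hx, ← mul_assoc, kpart_mul_incl hx, ← act_mul,
      Matrix.GeneralLinearGroup.coe_mul]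
  · rw [elem, elem, if_neg (fun h' => hx (h.1 h')), if_neg hx]

lemma elem_mul_two (g : G) (v : Poly R) : elem (g * two) v = elem g v := by
  classical
  funext x
  have e : x * (g * two) = two * (x * g) := by rw [← mul_assoc, two_comm]
  have h : two * (x * g) ∈ KZ ↔ x * g ∈ KZ := KZ.mul_mem_cancel_left two_mem
  by_cases hx : x * g ∈ KZ
  · rw [elem, elem, e, if_pos (h.2 hx), if_pos hx, kpart_two_mul hx]
  · rw [elem, elem, e, if_neg (fun h' => hx (h.1 h')), if_neg hx]

/-- Induction on a finite set of cosets K ℚ₂ˣ s carrying the support: subtracting [s⁻¹, f(s)]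
removes the coset of s. -/
lemma cInd_le_span_elem {W : Submodule R (Poly R)} (hW : ∀ (k : K), ∀ v ∈ W, act R k v ∈ W) :
    (cInd W).toSubmodule ≤ Submodule.span R {f | ∃ g : G, ∃ v ∈ W, f = elem g v} := by
  classical
  suffices h : ∀ S : Finset G, ∀ f ∈ (cInd W).toSubmodule,
      (∀ x, f x ≠ 0 → ∃ s ∈ S, x * s⁻¹ ∈ KZ) →
      f ∈ Submodule.span R {f | ∃ g : G, ∃ v ∈ W, f = elem g v} by
    intro f hf
    obtain ⟨S, hS⟩ := (mem_cInd.1 hf).2.2.2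
    exact h S f hf hS
  intro S
  induction S using Finset.induction with
  | empty =>
    intro f hf hS
    have : f = 0 := by
      funext x
      by_contra hx
      simpa using hS x hx
    rw [this]
    exact Submodule.zero_mem _
  | insert s S hs ih =>
    intro f hf hS
    have hfs : f s ∈ W := (mem_cInd.1 hf).1 s
    rw [← sub_add_cancel f (elem s⁻¹ (f s))]
    refine Submodule.add_mem _ (ih _ (Submodule.sub_mem _ hf (elem_mem hW _ hfs)) fun x hx => ?_)
      (Submodule.subset_span ⟨_, _, hfs, rfl⟩)
    rw [Pi.sub_apply] at hx
    by_cases hxs : x * s⁻¹ ∈ KZ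
    · refine absurd ?_ hx
      rw [elem, if_pos hxs, ← apply_KZ hf hxs, inv_mul_cancel_right, sub_self]
    · rw [elem, if_neg hxs, sub_zero] at hx
      obtain ⟨t, ht, h⟩ := hS x hx
      rcases Finset.mem_insert.1 ht with rfl | ht
      · exact absurd h hxs
      · exact ⟨t, ht, h⟩

variable (R) in
/-- The element `[g, v_r]` of `𝓘(Sym^r R²)`, for the component `v_r` of degree `r` of `v`. -/
def elemI (r : ℕ) (g : G) : Poly R →ₗ[R] (cInd (Sym R r)).toSubmodule where
  toFun v := ⟨elem g (homogeneousComponent r v),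
    elem_mem (fun _ _ h => act_mem_Sym _ h) g (homogeneousComponent_mem r v)⟩
  map_add' v w := Subtype.ext (by
    change elem g _ = elem g _ + elem g _
    rw [map_add, elem_add])
  map_smul' c v := Subtype.ext (by
    change elem g _ = c • elem g _
    rw [map_smul, elem_smul])

lemma homogeneousComponent_of_mem_Sym {R : Type*} [CommRing R] {r : ℕ} {v : Poly R}
    (hv : v ∈ Sym R r) :
    homogeneousComponent r v = v := by
  rw [homogeneousComponent_of_mem hv, if_pos rfl]

lemma coe_elemI {r : ℕ} (g : G) {v : Poly R} (hv : v ∈ Sym R r) :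
    (elemI R r g v : G → Poly R) = elem g v := by
  change elem g (homogeneousComponent r v) = _
  rw [homogeneousComponent_of_mem_Sym hv]

lemma elemI_mul_incl {r : ℕ} (g : G) (k : K) {v : Poly R} (hv : v ∈ Sym R r) :
    elemI R r (g * incl k) v = elemI R r g (act R k v) :=
  Subtype.ext (by rw [coe_elemI _ hv, coe_elemI _ (act_mem_Sym _ hv), elem_mul_incl])

lemma elemI_mul_two {r : ℕ} (g : G) (v : Poly R) : elemI R r (g * two) v = elemI R r g v :=
  Subtype.ext (elem_mul_two g _)

variable (R) in
/-- The operator `T` on `𝓘(Sym^r R²)`. -/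
def heckeI (r : ℕ) : (cInd (Sym R r)).toSubmodule →ₗ[R] (cInd (Sym R r)).toSubmodule :=
  (hecke R).restrict fun _ hf => hecke_mem hf

lemma heckeI_elemI {r : ℕ} (g : G) {v : Poly R} (hv : v ∈ Sym R r) :
    heckeI R r (elemI R r g v) =
      ∑ i, elemI R r (g * heckeG i) (act R (heckeMat i).adjugate v) := by
  apply Subtype.ext
  rw [AddSubmonoidClass.coe_finsetSum]
  simp only [coe_elemI _ (act_mem_Sym _ hv)]
  change hecke R (elemI R r g v).1 = _
  rw [coe_elemI _ hv, hecke_elem]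

end Elementary

/-! ### Relations in `Θ̄` -/

lemma coeffMap_mem (R' : Type*) [CommRing R'] [Algebra ZBar R'] [Algebra ℤ_[2] R']
    [IsScalarTower ℤ_[2] ZBar R'] {r : ℕ} {f : G → Poly ZBar}
    (hf : f ∈ (cInd (Sym ZBar r)).toSubmodule) :
    coeffMap R' f ∈ (cInd (Sym R' r)).toSubmodule := by
  obtain ⟨h1, h2, h3, S, hS⟩ := mem_cInd.1 hf
  refine ⟨fun x => map_mem_Sym _ (h1 x), fun k x => ?_, fun x => ?_, S, fun x hx => hS x ?_⟩
  · rw [coeffMap_apply, coeffMap_apply, h2, map_act]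
  · rw [coeffMap_apply, coeffMap_apply, h3]
  · intro h
    rw [coeffMap_apply, h, map_zero] at hx
    exact hx rfl

lemma coeffMap_hecke (R' : Type*) [CommRing R'] [Algebra ZBar R'] [Algebra ℤ_[2] R']
    [IsScalarTower ℤ_[2] ZBar R'] (f : G → Poly ZBar) :
    coeffMap R' (hecke ZBar f) = hecke R' (coeffMap R' f) := by
  funext x
  simp only [coeffMap_apply, hecke_apply, map_sum, map_act]

lemma coeffMap_smul_QBar (c : ZBar) (f : G → Poly ZBar) :
    coeffMap QBar (c • f) = (c : QBar) • coeffMap QBar f := by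
  rw [map_smul]
  funext x
  exact (algebraMap_smul QBar c (coeffMap QBar f x)).symm

/-- Here F = (T - a)(d⁻¹f), where d⁻¹f need only be rational. The lattice Θ is divided by all
integral elements of the rational image, and this is where relations beyond (T - a) of integral
functions come from. -/
lemma toTheta_eq_zero {a : ZBar} {r : ℕ} {d : ZBar} (hd : d ≠ 0)
    {f F : (cInd (Sym ZBar r)).toSubmodule} (h : d • F = heckeI ZBar r f - a • f) :
    toTheta (a : QBar) r F = 0 := by
  refine (Submodule.Quotient.mk_eq_zero _).2 ?_
  refine ⟨F.2, ?_⟩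
  have hd' : (d : QBar) ≠ 0 := by simpa using hd
  refine ⟨(d : QBar)⁻¹ • coeffMap QBar f.1, Submodule.smul_mem _ _ (coeffMap_mem QBar f.2), ?_⟩
  have h1 : coeffMap QBar (d • F.1) = coeffMap QBar (hecke ZBar f.1 - a • f.1) :=
    congrArg (coeffMap QBar) (congrArg Subtype.val h)
  rw [map_sub, coeffMap_hecke, coeffMap_smul_QBar, coeffMap_smul_QBar] at h1
  rw [map_smul, LinearMap.sub_apply, LinearMap.smul_apply, LinearMap.id_apply, ← h1,
    inv_smul_smul₀ hd']
  rfl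

lemma red_elemI {r : ℕ} (g : G) {v : Poly ZBar} (hv : v ∈ Sym ZBar r) :
    red r (elemI ZBar r g v) = elemI FBar r g (MvPolynomial.map (algebraMap ZBar FBar) v) := by
  classical
  apply Subtype.ext
  funext x
  rw [red_apply, coe_elemI _ hv, coe_elemI _ (map_mem_Sym _ hv)]
  by_cases h : x * g ∈ KZ
  · rw [elem, elem, if_pos h, if_pos h, map_act]
  · rw [elem, elem, if_neg h, if_neg h, map_zero]

/-- The class of `P [g, v]` in `Θ̄ / 𝓕'₂`. -/
def cls (a : QBar) (r : ℕ) (g : G) : Poly FBar →ₗ[FBar] ThetaBar a r ⧸ (F2' a r).toSubmodule :=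
  Submodule.mkQ _ ∘ₗ P a r ∘ₗ elemI FBar r g

/-- The class in `Θ̄ / 𝓕'₂` of an element of `𝓘(Sym^r ℤ̄₂²)`. -/
def clsI (a : QBar) (r : ℕ) :
    (cInd (Sym ZBar r)).toSubmodule →ₗ[ZBar] ThetaBar a r ⧸ (F2' a r).toSubmodule :=
  (Submodule.mkQ (F2' a r).toSubmodule).restrictScalars ZBar ∘ₗ toThetaBar a r

lemma clsI_elemI (a : QBar) (r : ℕ) (g : G) {v : Poly ZBar} (hv : v ∈ Sym ZBar r) :
    clsI a r (elemI ZBar r g v) = cls a r g (MvPolynomial.map (algebraMap ZBar FBar) v) := by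
  change Submodule.mkQ _ (toThetaBar a r _) = Submodule.mkQ _ (P a r (elemI FBar r g _))
  rw [← red_elemI _ hv, P_red]
  rfl

lemma clsI_eq_zero {a : ZBar} {r : ℕ} {d : ZBar} (hd : d ≠ 0)
    {f F : (cInd (Sym ZBar r)).toSubmodule} (h : d • F = heckeI ZBar r f - a • f) :
    clsI (a : QBar) r F = 0 := by
  change Submodule.mkQ _ ((1 : FBar) ⊗ₜ[ZBar] toTheta (a : QBar) r F) = 0
  rw [toTheta_eq_zero hd h, TensorProduct.tmul_zero, map_zero]

lemma cls_mul_incl (a : QBar) {r : ℕ} (g : G) (k : K) {v : Poly FBar} (hv : v ∈ V r) :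
    cls a r (g * incl k) v = cls a r g (act FBar k v) := by
  change Submodule.mkQ _ (P a r (elemI FBar r _ _)) = _
  rw [elemI_mul_incl g k hv]
  rfl

lemma cls_mul_two (a : QBar) (r : ℕ) (g : G) (v : Poly FBar) :
    cls a r (g * two) v = cls a r g v := by
  change Submodule.mkQ _ (P a r (elemI FBar r _ _)) = _
  rw [elemI_mul_two]
  rfl

/-! ### Forms -/

section

variable {R : Type*} [CommRing R]

lemma X_pow_mul_X_pow_mem_Sym {r i j : ℕ} (h : i + j = r) :
    (X 0 ^ i * X 1 ^ j : Poly R) ∈ Sym R r := by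
  have := ((isHomogeneous_X R (0 : Fin 2)).pow i).mul ((isHomogeneous_X R (1 : Fin 2)).pow j)
  rw [mem_homogeneousSubmodule]
  convert this using 1
  omega

/-- Gives homogeneity of the forms obtained by dividing by 2 or 4, from that of the forms before
division. -/
lemma mem_Sym_of_smul [IsDomain R] {r : ℕ} {d : R} (hd : d ≠ 0) {v : Poly R}
    (h : d • v ∈ Sym R r) : v ∈ Sym R r := by
  intro m hm
  refine h (d := m) ?_
  rw [coeff_smul, smul_eq_mul]
  exact mul_ne_zero hd hm

/-- The binomial expansion modulo 8. It is applied with x a square: since (X + 2Y)² = X² + 4Y(X +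
Y), it determines the even powers of X + 2Y modulo 8. -/
lemma exists_add_four_mul_pow (x t : R) (s : ℕ) :
    ∃ q, (x + 4 * t) ^ (s + 1) = x ^ (s + 1) + 4 * ((s + 1) * t * x ^ s) + 8 * q := by
  induction s with
  | zero => exact ⟨0, by push_cast; ring⟩
  | succ s ih =>
    obtain ⟨q, hq⟩ := ih
    refine ⟨q * (x + 4 * t) + 2 * ((s + 1) * t * x ^ s * t), ?_⟩
    rw [pow_succ, hq]
    push_cast
    ring

variable [Algebra ℤ_[2] R]

lemma C_algebraMap_two : (C (algebraMap ℤ_[2] R 2) : Poly R) = 2 := by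
  rw [map_ofNat, map_ofNat]

lemma act_adjugate_zero_X_zero : act R (heckeMat 0).adjugate (X 0) = X 0 := by
  simp [act_X, heckeMat, Matrix.adjugate_fin_two_of]

lemma act_adjugate_zero_X_one : act R (heckeMat 0).adjugate (X 1) = 2 * X 1 := by
  simp [act_X, heckeMat, Matrix.adjugate_fin_two_of, C_algebraMap_two]

lemma act_adjugate_one_X_zero : act R (heckeMat 1).adjugate (X 0) = X 0 := by
  simp [act_X, heckeMat, Matrix.adjugate_fin_two_of]

lemma act_adjugate_one_X_one : act R (heckeMat 1).adjugate (X 1) = 2 * X 1 - X 0 := by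
  simp [act_X, heckeMat, Matrix.adjugate_fin_two_of, C_algebraMap_two]
  ring

lemma act_adjugate_two_X_zero : act R (heckeMat 2).adjugate (X 0) = 2 * X 0 := by
  simp [act_X, heckeMat, Matrix.adjugate_fin_two_of, C_algebraMap_two]

lemma act_adjugate_two_X_one : act R (heckeMat 2).adjugate (X 1) = X 1 := by
  simp [act_X, heckeMat, Matrix.adjugate_fin_two_of]

lemma act_of_X_zero (a b c d : ℤ_[2]) : act R !![a, b; c, d] (X 0) =
    C (algebraMap ℤ_[2] R a) * X 0 + C (algebraMap ℤ_[2] R c) * X 1 := by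
  simp [act_X]

lemma act_of_X_one (a b c d : ℤ_[2]) : act R !![a, b; c, d] (X 1) =
    C (algebraMap ℤ_[2] R b) * X 0 + C (algebraMap ℤ_[2] R d) * X 1 := by
  simp [act_X]

end

lemma θ_mul_mem_Vfil_one {r : ℕ} (hr : 3 ≤ r) {u : Poly FBar} (hu : u ∈ V (r - 3)) :
    θ * u ∈ Vfil r 1 := by
  rw [Vfil, if_pos (by omega)]
  exact ⟨u, hu, by simp⟩

lemma Wone_le {r : ℕ} (hr : 6 ≤ r) : Wone r ≤ V r := by
  refine sup_le ?_ (Submodule.span_le.2 ?_)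
  · rw [Vfil, if_pos (by omega)]
    rintro _ ⟨u, hu, rfl⟩
    have := (((mem_homogeneousSubmodule _ _).1 θ_mem).pow 2).mul
      ((mem_homogeneousSubmodule _ _).1 hu)
    rw [mem_homogeneousSubmodule]
    convert this using 1
    · rfl
    · omega
  · rintro _ (rfl | rfl)
    · refine Vfil_one_le r (θ_mul_mem_Vfil_one (by omega) ?_)
      simpa using X_pow_mul_X_pow_mem_Sym (R := FBar) (Nat.add_zero (r - 3))
    · refine Vfil_one_le r (θ_mul_mem_Vfil_one (by omega) ?_)
      simpa using X_pow_mul_X_pow_mem_Sym (R := FBar) (Nat.zero_add (r - 3))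

lemma θ_mul_X_zero_pow_mem (r : ℕ) : θ * X 0 ^ (r - 3) ∈ Wone r :=
  Submodule.mem_sup_right (Submodule.subset_span (by simp))

lemma θ_mul_X_one_pow_mem (r : ℕ) : θ * X 1 ^ (r - 3) ∈ Wone r :=
  Submodule.mem_sup_right (Submodule.subset_span (by simp))

/-- Since θ²XⁱYʲ = θ(X^{i+2}Y^{j+1} - X^{i+1}Y^{j+2}), consecutive interior monomials agree after
multiplication by θ and reduction modulo V_r^{(2)}. -/
lemma θ_mul_sub_mem_Wone {r : ℕ} (hr : 6 ≤ r) {i j : ℕ} (hj : i + (j + 1) = r - 3)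
    (hi : 0 < i) : θ * (X 0 ^ i * X 1 ^ (j + 1) - X 0 ^ (r - 4) * X 1) ∈ Wone r := by
  induction j generalizing i with
  | zero =>
    have : i = r - 4 := by omega
    rw [this, zero_add, pow_one, sub_self, mul_zero]
    exact Submodule.zero_mem _
  | succ j ih =>
    obtain ⟨i, rfl⟩ : ∃ i', i = i' + 1 := ⟨i - 1, by omega⟩
    have h1 := ih (i := i + 2) (by omega) (by omega)
    have h2 : θ ^ 2 * (X 0 ^ i * X 1 ^ j) ∈ Wone r := by
      refine Submodule.mem_sup_left ?_
      rw [Vfil, if_pos (by omega)]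
      exact ⟨_, X_pow_mul_X_pow_mem_Sym (by omega), rfl⟩
    convert Submodule.sub_mem _ h1 h2 using 1
    simp only [θ]
    ring

/-- `θ u` is congruent to a multiple of `θ X^{r-4} Y` modulo the space `Wone r`. -/
lemma θ_mul_sub_middle_mem_Wone {r : ℕ} (hr : 6 ≤ r) {u : Poly FBar} (hu : u ∈ V (r - 3)) :
    θ * (u - C (middle (r - 3) u) * (X 0 ^ (r - 4) * X 1)) ∈ Wone r := by
  have h2 : (1 : FBar) + 1 = 0 := by rw [one_add_one_eq_two, two_eq_zero]
  -- The expression is linear in u, so it suffices to treat monomials. The two extreme ones have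
  -- `middle` equal to 1 + 1 = 0 and give the generators of W; the interior ones have `middle` equal
  -- to 1.
  let L : Poly FBar →ₗ[FBar] Poly FBar := LinearMap.mulLeft FBar θ ∘ₗ
    (LinearMap.id - (middle (r - 3)).smulRight (X 0 ^ (r - 4) * X 1))
  have hL : ∀ u, L u = θ * (u - C (middle (r - 3) u) * (X 0 ^ (r - 4) * X 1)) := fun u => by
    simp [L, MvPolynomial.smul_eq_C_mul]
  have key : ∀ i j, i + j = r - 3 → L (X 0 ^ i * X 1 ^ j) ∈ Wone r := by
    intro i j hij
    rw [hL, middle_eq (by omega) (X_pow_mul_X_pow_mem_Sym hij)]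
    simp only [map_mul, map_pow, eval_X, Matrix.cons_val_zero, Matrix.cons_val_one, one_pow,
      mul_one, one_mul]
    rcases j with _ | j
    · rw [zero_pow (by omega : i ≠ 0), pow_zero, pow_zero, add_zero, h2, C_0, zero_mul, sub_zero,
        mul_one, show i = r - 3 by omega]
      exact θ_mul_X_zero_pow_mem r
    · rcases i with _ | i
      · rw [zero_pow (by omega : j + 1 ≠ 0), pow_zero, pow_zero, add_zero, h2, C_0, zero_mul,
          sub_zero, one_mul, show j + 1 = r - 3 by omega]
        exact θ_mul_X_one_pow_mem r
      · rw [zero_pow (by omega), zero_pow (by omega), add_zero, add_zero, C_1, one_mul]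
        exact θ_mul_sub_mem_Wone hr hij (by omega)
  rw [← hL, u.as_sum, map_sum]
  refine Submodule.sum_mem _ fun d hd => ?_
  have hdeg : d 0 + d 1 = r - 3 := by
    have h := (mem_homogeneousSubmodule _ _).1 hu (mem_support_iff.1 hd)
    have h' := Finsupp.degree_eq_weight_one (R := ℕ) (σ := Fin 2)
    rw [show (1 : Fin 2 → ℕ) = fun _ => 1 from rfl] at h
    rw [← show Finsupp.degree d = r - 3 by rw [h']; exact h, Finsupp.degree_eq_sum,
      Fin.sum_univ_two]
  rw [monomial_eq, Finsupp.prod_fintype _ _ (by simp), Fin.prod_univ_two,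
    ← MvPolynomial.smul_eq_C_mul, map_smul]
  exact Submodule.smul_mem _ _ (key _ _ hdeg)

/-- Together with `exists_eq_θ_mul` this identifies W with θ · ker(`middle`). Stability of W under
`K` then follows from the invariance of θ and of `middle`. -/
lemma θ_mul_mem_Wone {r : ℕ} (hr : 6 ≤ r) {u : Poly FBar} (hu : u ∈ V (r - 3))
    (h : middle (r - 3) u = 0) : θ * u ∈ Wone r := by
  simpa [h] using θ_mul_sub_middle_mem_Wone hr hu

lemma exists_eq_θ_mul {r : ℕ} (hr : 6 ≤ r) {v : Poly FBar} (hv : v ∈ Wone r) :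
    ∃ u ∈ V (r - 3), middle (r - 3) u = 0 ∧ v = θ * u := by
  have h2 : (1 : FBar) + 1 = 0 := by rw [one_add_one_eq_two, two_eq_zero]
  suffices h : Wone r ≤ ((V (r - 3)) ⊓ LinearMap.ker (middle (r - 3))).map
      (LinearMap.mulLeft FBar θ) by
    obtain ⟨u, ⟨hu, hm⟩, rfl⟩ := h hv
    exact ⟨u, hu, hm, rfl⟩
  have hX : (X 0 ^ (r - 3) : Poly FBar) ∈ V (r - 3) := by
    simpa using X_pow_mul_X_pow_mem_Sym (R := FBar) (Nat.add_zero (r - 3))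
  have hY : (X 1 ^ (r - 3) : Poly FBar) ∈ V (r - 3) := by
    simpa using X_pow_mul_X_pow_mem_Sym (R := FBar) (Nat.zero_add (r - 3))
  have hn : r - 3 ≠ 0 := by omega
  refine sup_le ?_ (Submodule.span_le.2 ?_)
  · rw [Vfil, if_pos (by omega)]
    rintro _ ⟨u, hu, rfl⟩
    have hθu : θ * u ∈ V (r - 3) := by
      have := ((mem_homogeneousSubmodule _ _).1 θ_mem).mul ((mem_homogeneousSubmodule _ _).1 hu)
      rw [mem_homogeneousSubmodule]
      convert this using 1
      omega
    refine ⟨θ * u, ⟨hθu, ?_⟩, ?_⟩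
    · rw [SetLike.mem_coe, LinearMap.mem_ker, middle_eq hn hθu]
      simp [θ]
    · simp only [LinearMap.mulLeft_apply]
      ring
  · rintro _ (rfl | rfl)
    · refine ⟨X 0 ^ (r - 3), ⟨hX, ?_⟩, rfl⟩
      rw [SetLike.mem_coe, LinearMap.mem_ker, middle_eq hn hX]
      simp [hn, h2]
    · refine ⟨X 1 ^ (r - 3), ⟨hY, ?_⟩, rfl⟩
      rw [SetLike.mem_coe, LinearMap.mem_ker, middle_eq hn hY]
      simp [hn, h2]

lemma act_mem_Wone {r : ℕ} (hr : 6 ≤ r) (k : K) {v : Poly FBar} (hv : v ∈ Wone r) :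
    act FBar k v ∈ Wone r := by
  obtain ⟨u, hu, hm, rfl⟩ := exists_eq_θ_mul hr hv
  rw [map_mul, act_θ]
  exact θ_mul_mem_Wone hr (act_mem_Sym _ hu) (by rw [middle_act _ k hu, hm])

/-! ### Relations between the classes of elementary functions -/

lemma cls_eq_zero {a : QBar} {r : ℕ} (hr : 6 ≤ r) (g : G) {v : Poly FBar} (hv : v ∈ Wone r) :
    cls a r g v = 0 := by
  refine (Submodule.Quotient.mk_eq_zero _).2 ⟨elemI FBar r g v, ?_, rfl⟩
  change (elemI FBar r g v : G → Poly FBar) ∈ (cInd (Wone r)).toSubmodule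
  rw [coe_elemI _ (Wone_le hr hv)]
  exact elem_mem (fun k _ h => act_mem_Wone hr k h) g hv

lemma two_ne_zero_ZBar : (2 : ZBar) ≠ 0 := by
  intro h
  have : (2 : QBar) = 0 := congrArg Subtype.val h
  exact two_ne_zero this

lemma four_ne_zero_ZBar : (4 : ZBar) ≠ 0 := by
  have : (4 : ZBar) = 2 * 2 := by norm_num
  rw [this]
  exact mul_ne_zero two_ne_zero_ZBar two_ne_zero_ZBar

/-- The relation in `Θ̄` obtained from `d⁻¹ (T - a) [g, w]`, when this is integral. -/
lemma cls_sum_eq {a d : ZBar} (hd : d ≠ 0) {r : ℕ} (g : G) {w : Poly ZBar} (hw : w ∈ Sym ZBar r)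
    (u : Fin 3 → Poly ZBar) (hu : ∀ i, act ZBar (heckeMat i).adjugate w = d • u i)
    {z : Poly ZBar} (hz : a • w = d • z) :
    ∑ i, cls (a : QBar) r (g * heckeG i) (MvPolynomial.map (algebraMap ZBar FBar) (u i)) =
      cls (a : QBar) r g (MvPolynomial.map (algebraMap ZBar FBar) z) := by
  have hu' : ∀ i, u i ∈ Sym ZBar r := fun i => mem_Sym_of_smul hd (hu i ▸ act_mem_Sym _ hw)
  have hz' : z ∈ Sym ZBar r := mem_Sym_of_smul hd (hz ▸ Submodule.smul_mem _ a hw)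
  have h := clsI_eq_zero (a := a) (r := r) hd (f := elemI ZBar r g w)
    (F := ∑ i, elemI ZBar r (g * heckeG i) (u i) - elemI ZBar r g z) (by
      rw [heckeI_elemI g hw, ← map_smul, hz, smul_sub, Finset.smul_sum]
      simp only [hu, map_smul])
  rw [map_sub, map_sum, clsI_elemI _ _ _ hz', sub_eq_zero] at h
  rw [← h]
  exact Finset.sum_congr rfl fun i _ => (clsI_elemI _ _ _ (hu' i)).symm

lemma two_smul_FBar {M : Type*} [AddCommGroup M] [Module FBar M] (x : M) : x + x = 0 := by
  rw [← two_smul FBar x, two_eq_zero, zero_smul]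

/-! ### Relations from T - a applied to a single elementary function -/

section Slope

variable {a α : ZBar} {N : ℕ}

/-- Apply T - a to [g α₁⁻¹, X^{r-1}Y]. Modulo 2 only the term X^{r-1}(2Y - X) ≡ -X^r survives, and
it sits at g; the other two terms and a itself are even. -/
lemma cls_X_zero_pow (ha : a = 2 * α) (g : G) :
    cls (a : QBar) (N + 6) g (X 0 ^ (N + 6)) = 0 := by
  have h2 := two_poly_eq_zero
  have h := cls_sum_eq (a := a) one_ne_zero (r := N + 6) (g * (heckeG 1)⁻¹)
    (w := X 0 ^ (N + 5) * X 1 ^ 1) (X_pow_mul_X_pow_mem_Sym rfl)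
    ![X 0 ^ (N + 5) * (2 * X 1), X 0 ^ (N + 5) * (2 * X 1 - X 0), (2 * X 0) ^ (N + 5) * X 1]
    (by
      intro i
      rw [one_smul]
      fin_cases i <;> simp [act_adjugate_zero_X_zero, act_adjugate_zero_X_one,
        act_adjugate_one_X_zero, act_adjugate_one_X_one, act_adjugate_two_X_zero,
        act_adjugate_two_X_one])
    (z := C (2 * α) * (X 0 ^ (N + 5) * X 1 ^ 1)) (by rw [one_smul, MvPolynomial.smul_eq_C_mul, ha])
  simp only [Fin.sum_univ_three, Matrix.cons_val_zero, Matrix.cons_val_one,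
    Matrix.cons_val, map_mul, map_pow, map_sub, map_X, map_ofNat, h2, zero_mul, mul_zero, map_zero,
    zero_sub, ne_eq, Nat.add_eq_zero_iff, OfNat.ofNat_ne_zero, and_false,
    not_false_eq_true, zero_pow, add_zero, zero_add, inv_mul_cancel_right, mul_neg, map_neg,
    neg_eq_zero] at h
  rw [pow_succ]
  exact h

/-- Apply (T - a)/2 to [g, w] with w = X^{r-2}Y² - X^{r-3}Y³, a lift of θX^{r-4}Y. Substituting Y ↦
2Y - X turns the factor X - Y of w into 2(X - Y). So the α₁-term is divisible by 2 exactly once and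
leaves X^r - X^{r-1}Y, while the other two terms stay even after division. -/
lemma cls_heckeG_one (ha : a = 2 * α) (g : G) :
    cls (a : QBar) (N + 6) (g * heckeG 1) (X 0 ^ (N + 5) * X 1) =
      algebraMap ZBar FBar α •
        cls (a : QBar) (N + 6) g (θ * (X 0 ^ (N + 2) * X 1)) := by
  have h2 := two_poly_eq_zero
  have h := cls_sum_eq (a := a) two_ne_zero_ZBar (r := N + 6) g
    (w := X 0 ^ (N + 4) * X 1 ^ 2 - X 0 ^ (N + 3) * X 1 ^ 3)
    (Submodule.sub_mem _ (X_pow_mul_X_pow_mem_Sym rfl) (X_pow_mul_X_pow_mem_Sym rfl))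
    ![2 * (X 0 ^ (N + 3) * X 1 ^ 2 * (X 0 - 2 * X 1)),
      X 0 ^ (N + 3) * (2 * X 1 - X 0) ^ 2 * (X 0 - X 1),
      2 * (2 ^ (N + 1) * (X 0 ^ (N + 3) * X 1 ^ 2 * (2 * X 0 - X 1)))]
    (by
      intro i
      rw [MvPolynomial.smul_eq_C_mul, map_ofNat]
      fin_cases i <;> simp [act_adjugate_zero_X_zero, act_adjugate_zero_X_one,
        act_adjugate_one_X_zero, act_adjugate_one_X_one, act_adjugate_two_X_zero,
        act_adjugate_two_X_one] <;> ring)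
    (z := C α * (X 0 ^ (N + 4) * X 1 ^ 2 - X 0 ^ (N + 3) * X 1 ^ 3))
    (by simp only [MvPolynomial.smul_eq_C_mul, map_mul, ha]; ring)
  simp only [Fin.sum_univ_three, Matrix.cons_val_zero, Matrix.cons_val_one,
    Matrix.cons_val, map_mul, map_pow, map_sub, map_X, map_C, map_ofNat, h2, zero_mul,
    map_zero, zero_add, add_zero] at h
  have e1 : (X 0 ^ (N + 3) * (0 - X 0) ^ 2 * (X 0 - X 1) : Poly FBar) =
      X 0 ^ (N + 6) - X 0 ^ (N + 5) * X 1 := by ring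
  have e2 : (C (algebraMap ZBar FBar α) * (X 0 ^ (N + 4) * X 1 ^ 2 - X 0 ^ (N + 3) * X 1 ^ 3) :
      Poly FBar) = algebraMap ZBar FBar α • (θ * (X 0 ^ (N + 2) * X 1)) := by
    rw [MvPolynomial.smul_eq_C_mul, θ]; ring
  rw [e1, e2, map_sub, map_smul, cls_X_zero_pow ha (g * heckeG 1), zero_sub] at h
  rw [← h, eq_neg_iff_add_eq_zero]
  exact two_smul_FBar _

lemma cls_X_zero_sq (g : G) :
    cls (a : QBar) (N + 6) g (X 0 ^ (N + 4) * X 1 ^ 2) =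
      cls (a : QBar) (N + 6) g (X 0 ^ (N + 5) * X 1) := by
  have h := cls_eq_zero (a := (a : QBar)) (by omega) g (θ_mul_X_zero_pow_mem (N + 6))
  rw [← sub_eq_zero, ← map_sub, ← neg_eq_zero, ← map_neg, ← h]
  congr 1
  simp only [θ, Nat.reduceSubDiff]
  ring

end Slope

/-- The matrix `(0 1; 1 0)` in `K`. -/
def swapK : K := Matrix.GeneralLinearGroup.mk'' !![0, 1; 1, 0] (by simp [Matrix.det_fin_two_of])

/-- The matrix `(1 0; 1 1)` in `K`. -/
def lowerK : K := Matrix.GeneralLinearGroup.mk'' !![1, 0; 1, 1] (by simp [Matrix.det_fin_two_of])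

lemma coe_swapK : (swapK : Matrix (Fin 2) (Fin 2) ℤ_[2]) = !![0, 1; 1, 0] := rfl

lemma coe_lowerK : (lowerK : Matrix (Fin 2) (Fin 2) ℤ_[2]) = !![1, 0; 1, 1] := rfl

/-- Representatives in `K` of the three lines of `𝔽₂²`. -/
def lineK : Fin 3 → K := ![1, swapK, lowerK]

/-! ### Forms for the relation at a vertex and its three neighbours -/

section

variable {R : Type*} [CommRing R] [Algebra ℤ_[2] R]

lemma act_swapK_X_zero : act R (swapK : Matrix (Fin 2) (Fin 2) ℤ_[2]) (X 0) = X 1 := by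
  simp [coe_swapK, act_of_X_zero]

lemma act_swapK_X_one : act R (swapK : Matrix (Fin 2) (Fin 2) ℤ_[2]) (X 1) = X 0 := by
  simp [coe_swapK, act_of_X_one]

lemma act_lowerK_X_zero : act R (lowerK : Matrix (Fin 2) (Fin 2) ℤ_[2]) (X 0) = X 0 + X 1 := by
  simp [coe_lowerK, act_of_X_zero]

lemma act_lowerK_X_one : act R (lowerK : Matrix (Fin 2) (Fin 2) ℤ_[2]) (X 1) = X 1 := by
  simp [coe_lowerK, act_of_X_one]

end

/-- The three vertices g kⱼ α₁⁻¹ are the neighbours of g. Under T, the α₁-term of each one lands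
back at g, twisted by kⱼ. -/
lemma elemI_line {r : ℕ} (g : G) (j : Fin 3) {v : Poly ZBar} (hv : v ∈ Sym ZBar r) :
    elemI ZBar r (g * incl (lineK j) * (heckeG 1)⁻¹ * heckeG 1) v =
      elemI ZBar r g (act ZBar (lineK j : K) v) := by
  rw [inv_mul_cancel_right, elemI_mul_incl _ _ hv]

/-- The forms `b = (X + Y)^r - X^r - Y^r + 2 X^{r-2} Y^2`, `c i = (adj(α_i) · b) / 4` and `q`. -/
lemma exists_neighbour_forms (S : ℕ) : ∃ (b q : Poly ZBar) (c : Fin 3 → Poly ZBar),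
    b ∈ Sym ZBar (2 * S + 6) ∧ q ∈ Sym ZBar (2 * S + 6) ∧ (∀ i, c i ∈ Sym ZBar (2 * S + 6)) ∧
    (∀ i, act ZBar (heckeMat i).adjugate b = (4 : ZBar) • c i) ∧
    ∑ j, act ZBar (lineK j : K) (act ZBar (heckeMat 1).adjugate (X 0 ^ (2 * S + 4) * X 1 ^ 2)) - b =
      (2 : ZBar) • q ∧
    MvPolynomial.map (algebraMap ZBar FBar) q =
      X 0 ^ (2 * S + 6) + X 1 ^ (2 * S + 6) - X 0 ^ (2 * S + 4) * X 1 ^ 2 ∧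
    ∀ i, MvPolynomial.map (algebraMap ZBar FBar) (c i) ∈ Wone (2 * S + 6) := by
  have h2 := two_poly_eq_zero
  let x : Poly ZBar := X 0
  let y : Poly ZBar := X 1
  have hSym : ∀ {i j}, i + j = 2 * S + 6 → x ^ i * y ^ j ∈ Sym ZBar (2 * S + 6) :=
    fun h => X_pow_mul_X_pow_mem_Sym h
  obtain ⟨q₀, hq₀⟩ := exists_add_four_mul_pow (x ^ 2) (y * (x + y)) (S + 2)
  obtain ⟨q₁, hq₁⟩ := exists_add_four_mul_pow (x ^ 2) (y * (y - x)) (S + 2)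
  obtain ⟨q₂, hq₂⟩ := exists_add_four_mul_pow (y ^ 2) (x * (x + y)) (S + 2)
  -- Here the evenness of r enters: 2S + 6 = 2(S + 2 + 1), so each r-th power is a power of a
  -- square.
  have e₀ : (x + 2 * y) ^ (2 * S + 6) = (x ^ 2 + 4 * (y * (x + y))) ^ (S + 2 + 1) := by
    rw [show x ^ 2 + 4 * (y * (x + y)) = (x + 2 * y) ^ 2 by ring, ← pow_mul]; congr 1
  have e₁ : (2 * y - x) ^ (2 * S + 6) = (x ^ 2 + 4 * (y * (y - x))) ^ (S + 2 + 1) := by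
    rw [show x ^ 2 + 4 * (y * (y - x)) = (2 * y - x) ^ 2 by ring, ← pow_mul]; congr 1
  have e₂ : (2 * x + y) ^ (2 * S + 6) = (y ^ 2 + 4 * (x * (x + y))) ^ (S + 2 + 1) := by
    rw [show y ^ 2 + 4 * (x * (x + y)) = (2 * x + y) ^ 2 by ring, ← pow_mul]; congr 1
  push_cast at hq₀ hq₁ hq₂
  set m : Poly ZBar := x ^ (2 * S + 4) * y ^ 2 with hm
  -- Up to sign, (X + Y)^r - X^r - Y^r agrees modulo 2 with the sum of the three terms returning to
  -- g. The summand 2m cancels the -2X^r that Y ↦ 2Y - X would otherwise leave modulo 4, so that all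
  -- three images of b are divisible by 4.
  set b : Poly ZBar := (x + y) ^ (2 * S + 6) - x ^ (2 * S + 6) - y ^ (2 * S + 6) + 2 * m with hb
  let q : Poly ZBar := x ^ (2 * S + 6) + y ^ (2 * S + 6) - m + 2 * (x ^ (2 * S + 4) * (y * (y - x))
    + y ^ (2 * S + 4) * (x * (x - y)) - (x + y) ^ (2 * S + 4) * (x * y))
  let c : Fin 3 → Poly ZBar := ![(S + 3) * (y * (x + y)) * x ^ (2 * S + 4) + 2 * q₀ -
      2 ^ (2 * S + 4) * y ^ (2 * S + 6) + 2 * m,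
    2 ^ (2 * S + 4) * y ^ (2 * S + 6) - (S + 3) * (y * (y - x)) * x ^ (2 * S + 4) - 2 * q₁ +
      2 * (x ^ (2 * S + 4) * (y * (y - x))),
    (S + 3) * (x * (x + y)) * y ^ (2 * S + 4) + 2 * q₂ -
      2 ^ (2 * S + 4) * x ^ (2 * S + 6) + 2 ^ (2 * S + 3) * m]
  have hmS : m ∈ Sym ZBar (2 * S + 6) := hSym (by omega)
  have hx : x ^ (2 * S + 6) ∈ Sym ZBar (2 * S + 6) := by
    simpa using hSym (Nat.add_zero (2 * S + 6))
  have hy : y ^ (2 * S + 6) ∈ Sym ZBar (2 * S + 6) := by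
    simpa using hSym (Nat.zero_add (2 * S + 6))
  have hxy : (x + y) ^ (2 * S + 6) ∈ Sym ZBar (2 * S + 6) := by
    have := act_mem_Sym (R := ZBar) (lowerK : Matrix (Fin 2) (Fin 2) ℤ_[2]) hx
    rwa [map_pow, act_lowerK_X_zero] at this
  have hbS : b ∈ Sym ZBar (2 * S + 6) := by
    refine Submodule.add_mem _ (Submodule.sub_mem _ (Submodule.sub_mem _ hxy hx) hy) ?_
    have := Submodule.smul_mem _ (2 : ZBar) hmS
    rwa [MvPolynomial.smul_eq_C_mul, map_ofNat] at this
  have hc : ∀ i, act ZBar (heckeMat i).adjugate b = (4 : ZBar) • c i := by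
    intro i
    rw [MvPolynomial.smul_eq_C_mul, map_ofNat]
    fin_cases i
    · simp only [hb, hm, x, y, c, map_add, map_sub, map_mul, map_pow, map_ofNat, Fin.zero_eta,
        act_adjugate_zero_X_zero, act_adjugate_zero_X_one, Matrix.cons_val_zero]
      change (x + 2 * y) ^ (2 * S + 6) - x ^ (2 * S + 6) - (2 * y) ^ (2 * S + 6) + 2 *
        (x ^ (2 * S + 4) * (2 * y) ^ 2) = 4 * ((S + 3) * (y * (x + y)) * x ^ (2 * S + 4) + 2 * q₀ -
          2 ^ (2 * S + 4) * y ^ (2 * S + 6) + 2 * (x ^ (2 * S + 4) * y ^ 2))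
      rw [e₀, hq₀]
      ring
    · simp only [hb, hm, x, y, c, map_add, map_sub, map_mul, map_pow, map_ofNat, Fin.mk_one,
        act_adjugate_one_X_zero, act_adjugate_one_X_one, Matrix.cons_val_one,
        Matrix.cons_val_zero]
      change (x + (2 * y - x)) ^ (2 * S + 6) - x ^ (2 * S + 6) - (2 * y - x) ^ (2 * S + 6) + 2 *
        (x ^ (2 * S + 4) * (2 * y - x) ^ 2) = 4 * (2 ^ (2 * S + 4) * y ^ (2 * S + 6) -
          (S + 3) * (y * (y - x)) * x ^ (2 * S + 4) - 2 * q₁ +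
          2 * (x ^ (2 * S + 4) * (y * (y - x))))
      rw [e₁, hq₁]
      ring
    · simp only [hb, hm, x, y, c, map_add, map_sub, map_mul, map_pow, map_ofNat,
        Fin.reduceFinMk, act_adjugate_two_X_zero, act_adjugate_two_X_one, Matrix.cons_val]
      change (2 * x + y) ^ (2 * S + 6) - (2 * x) ^ (2 * S + 6) - y ^ (2 * S + 6) + 2 *
        ((2 * x) ^ (2 * S + 4) * y ^ 2) = 4 * ((S + 3) * (x * (x + y)) * y ^ (2 * S + 4) + 2 * q₂ -
          2 ^ (2 * S + 4) * x ^ (2 * S + 6) + 2 ^ (2 * S + 3) * (x ^ (2 * S + 4) * y ^ 2))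
      rw [e₂, hq₂]
      ring
  have hcS : ∀ i, c i ∈ Sym ZBar (2 * S + 6) := fun i =>
    mem_Sym_of_smul four_ne_zero_ZBar (hc i ▸ act_mem_Sym _ hbS)
  have hu : act ZBar (heckeMat 1).adjugate m = x ^ (2 * S + 4) * (2 * y - x) ^ 2 := by
    simp only [hm, x, y, map_mul, map_pow, act_adjugate_one_X_zero, act_adjugate_one_X_one]
  have hq : ∑ j, act ZBar (lineK j : K) (act ZBar (heckeMat 1).adjugate m) - b =
      (2 : ZBar) • q := by
    rw [MvPolynomial.smul_eq_C_mul, map_ofNat, hu]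
    simp only [lineK, Fin.sum_univ_three, Matrix.cons_val_zero, Matrix.cons_val_one,
      Matrix.cons_val, map_mul, map_pow, map_sub, map_ofNat, x, y, act_swapK_X_zero,
      act_swapK_X_one, act_lowerK_X_zero, act_lowerK_X_one, Units.val_one, act_one, q, hb, hm]
    ring
  have hqS : q ∈ Sym ZBar (2 * S + 6) := mem_Sym_of_smul two_ne_zero_ZBar (hq ▸
    Submodule.sub_mem _ (Submodule.sum_mem _ fun _ _ => act_mem_Sym _ (act_mem_Sym _ hmS)) hbS)
  have hq' : MvPolynomial.map (algebraMap ZBar FBar) q =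
      X 0 ^ (2 * S + 6) + X 1 ^ (2 * S + 6) - X 0 ^ (2 * S + 4) * X 1 ^ 2 := by
    simp [q, m, x, y, h2]
  -- Modulo 2 the quotients by 4 reduce to (S + 3)θX^{r-3} for i = 0, 1 and to (S + 3)θY^{r-3} for i
  -- = 2. These generators of W are what make the outer terms vanish.
  have hc' : ∀ i, MvPolynomial.map (algebraMap ZBar FBar) (c i) ∈ Wone (2 * S + 6) := by
    have hX := Submodule.smul_mem _ ((S : FBar) + 3) (θ_mul_X_zero_pow_mem (2 * S + 6))
    have hY := Submodule.smul_mem _ ((S : FBar) + 3) (θ_mul_X_one_pow_mem (2 * S + 6))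
    rw [MvPolynomial.smul_eq_C_mul] at hX hY
    simp only [θ, Nat.reduceSubDiff, map_add, map_natCast, map_ofNat] at hX hY
    intro i
    fin_cases i
    · convert hX using 1
      simp [c, m, x, y, h2]
      linear_combination (S + 3) * X 0 ^ (2 * S + 4) * X 1 ^ 2 * h2
    · convert hX using 1
      simp [c, m, x, y, h2]
      ring
    · convert hY using 1
      simp [c, m, x, y, h2, pow_succ]
      linear_combination (S + 3) * X 0 * X 1 ^ (2 * S + 5) * h2
  exact ⟨b, q, c, hbS, hqS, hcS, hc, hq, hq', hc'⟩

lemma act_adjugate_zero_sq (n : ℕ) : act ZBar (heckeMat 0).adjugate (X 0 ^ n * X 1 ^ 2) =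
    (4 : ZBar) • (X 0 ^ n * X 1 ^ 2) := by
  rw [MvPolynomial.smul_eq_C_mul, map_ofNat]
  simp only [map_mul, map_pow, act_adjugate_zero_X_zero, act_adjugate_zero_X_one]
  ring

lemma act_adjugate_two_sq (n : ℕ) : act ZBar (heckeMat 2).adjugate (X 0 ^ n * X 1 ^ 2) =
    (2 ^ n : ZBar) • (X 0 ^ n * X 1 ^ 2) := by
  rw [MvPolynomial.smul_eq_C_mul, map_pow, map_ofNat]
  simp only [map_mul, map_pow, act_adjugate_two_X_zero, act_adjugate_two_X_one]
  ring

/-- The linear bookkeeping for (T - a)f = 4F. The sᵢ collect the αᵢ-terms of T at the neighbours, t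
is the sum over the neighbours, 4u comes from T[g, b], and s₁ - b = 2q is the part supported at g.
-/
lemma hecke_neighbours_identity {M : Type*} [AddCommGroup M] [Module ZBar M] (α : ZBar) (n : ℕ)
    (s₀ s₁ s₂ t u b q : M) (h : s₁ - b = (2 : ZBar) • q) :
    (4 : ZBar) • ((2 * α) • s₀ + (2 * (2 ^ (n + 1) * α)) • s₂ + α • q - α ^ 2 • t + u) =
      (2 * α) • ((4 : ZBar) • s₀ + s₁ + (2 ^ (n + 3) : ZBar) • s₂) + (4 : ZBar) • u -
        (2 * α) • ((2 * α) • t + b) := by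
  obtain rfl : s₁ = (2 : ZBar) • q + b := by rw [← h, sub_add_cancel]
  module

/-! ### The relation between a vertex and its three neighbours -/

section Slope

variable {a α : ZBar} {S : ℕ}

/-- The relation obtained from `(T - a) f`, where `f` is supported at the vertex `g` and its three
neighbours. -/
lemma clsI_neighbours (ha : a = 2 * α) (g : G) {m b q : Poly ZBar} {c : Fin 3 → Poly ZBar}
    (hmS : m ∈ Sym ZBar (2 * S + 6)) (hbS : b ∈ Sym ZBar (2 * S + 6))
    (hm₀ : act ZBar (heckeMat 0).adjugate m = (4 : ZBar) • m)
    (hm₂ : act ZBar (heckeMat 2).adjugate m = (2 ^ (2 * S + 4) : ZBar) • m)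
    (hc : ∀ i, act ZBar (heckeMat i).adjugate b = (4 : ZBar) • c i)
    (hq : ∑ j, act ZBar (lineK j : K) (act ZBar (heckeMat 1).adjugate m) - b = (2 : ZBar) • q) :
    clsI (a : QBar) (2 * S + 6)
      ((2 * α) • ∑ j, elemI ZBar _ (g * incl (lineK j) * (heckeG 1)⁻¹ * heckeG 0) m +
      (2 * (2 ^ (2 * S + 1 + 1) * α)) •
        ∑ j, elemI ZBar _ (g * incl (lineK j) * (heckeG 1)⁻¹ * heckeG 2) m +
      α • elemI ZBar _ g q - α ^ 2 • ∑ j, elemI ZBar _ (g * incl (lineK j) * (heckeG 1)⁻¹) m +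
      ∑ i, elemI ZBar _ (g * heckeG i) (c i)) = 0 := by
  have hT : ∀ j, heckeI ZBar (2 * S + 6) (elemI ZBar _ (g * incl (lineK j) * (heckeG 1)⁻¹) m) =
      (4 : ZBar) • elemI ZBar _ (g * incl (lineK j) * (heckeG 1)⁻¹ * heckeG 0) m +
      elemI ZBar _ g (act ZBar (lineK j : K) (act ZBar (heckeMat 1).adjugate m)) +
      (2 ^ (2 * S + 4) : ZBar) •
        elemI ZBar _ (g * incl (lineK j) * (heckeG 1)⁻¹ * heckeG 2) m := by
    intro j
    rw [heckeI_elemI _ hmS, Fin.sum_univ_three, hm₀, hm₂, map_smul, map_smul,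
      elemI_line g j (act_mem_Sym _ hmS)]
  have hTb : heckeI ZBar (2 * S + 6) (elemI ZBar _ g b) =
      (4 : ZBar) • ∑ i, elemI ZBar (2 * S + 6) (g * heckeG i) (c i) := by
    rw [heckeI_elemI _ hbS, Finset.smul_sum]
    simp only [hc, map_smul]
  have hQ := congrArg (elemI ZBar (2 * S + 6) g) hq
  rw [map_sub, map_sum, map_smul] at hQ
  -- The weight a = 2α on the neighbours makes their contribution at g combine with -a[g, b] into 2α
  -- · 2q, which is divisible by 4.
  refine clsI_eq_zero four_ne_zero_ZBar
    (f := (2 * α) • ∑ j, elemI ZBar _ (g * incl (lineK j) * (heckeG 1)⁻¹) m + elemI ZBar _ g b) ?_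
  rw [hecke_neighbours_identity α _ _ _ _ _ _ _ _ hQ, map_add, map_smul, map_sum, hTb, ha]
  simp only [hT, Finset.sum_add_distrib, Finset.smul_sum]

lemma two_mul_smul_eq_zero {M : Type*} [AddCommGroup M] [Module FBar M] [Module ZBar M]
    [IsScalarTower ZBar FBar M] (t : ZBar) (z : M) : (2 * t) • z = 0 := by
  rw [← algebraMap_smul FBar, map_mul, map_ofNat, two_eq_zero, zero_mul, zero_smul]

/-- The terms s₀ and s₂, pointing away from g, carry even coefficients and die over 𝔽̄₂; only q at g
and the neighbours themselves remain. -/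
lemma smul_eq_smul_of_neighbours {M Q : Type*} [AddCommGroup M] [Module ZBar M] [AddCommGroup Q]
    [Module FBar Q] [Module ZBar Q] [IsScalarTower ZBar FBar Q] (L : M →ₗ[ZBar] Q) (β : ZBar)
    {s₀ s₂ t u q : M}
    (h : L ((2 * α) • s₀ + (2 * β) • s₂ + α • q - α ^ 2 • t + u) = 0) (hu : L u = 0) :
    algebraMap ZBar FBar α • L q = algebraMap ZBar FBar α ^ 2 • L t := by
  rw [map_add, map_sub, map_add, map_add, map_smul, map_smul, map_smul, map_smul, hu,
    two_mul_smul_eq_zero, two_mul_smul_eq_zero, zero_add, zero_add, add_zero, sub_eq_zero] at h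
  rwa [← map_pow, algebraMap_smul, algebraMap_smul]

/-- With the classes of X^r and Y^r equal to zero, this says λ A(g) = λ² ∑ A(h) over the neighbours
h of g. It is the only relation that links A at a vertex to A at adjacent ones. -/
lemma cls_neighbours (ha : a = 2 * α) (g : G) :
    algebraMap ZBar FBar α • cls (a : QBar) (2 * S + 6) g
      (X 0 ^ (2 * S + 6) + X 1 ^ (2 * S + 6) - X 0 ^ (2 * S + 4) * X 1 ^ 2) =
    algebraMap ZBar FBar α ^ 2 • ∑ j, cls (a : QBar) (2 * S + 6)
      (g * incl (lineK j) * (heckeG 1)⁻¹) (X 0 ^ (2 * S + 4) * X 1 ^ 2) := by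
  obtain ⟨b, q, c, hbS, hqS, hcS, hc, hq, hq', hc'⟩ := exists_neighbour_forms S
  have hmS : (X 0 ^ (2 * S + 4) * X 1 ^ 2 : Poly ZBar) ∈ Sym ZBar (2 * S + 6) :=
    X_pow_mul_X_pow_mem_Sym (by omega)
  have hm' : MvPolynomial.map (algebraMap ZBar FBar) (X 0 ^ (2 * S + 4) * X 1 ^ 2 : Poly ZBar) =
      X 0 ^ (2 * S + 4) * X 1 ^ 2 := by simp
  have hrel := clsI_neighbours ha g hmS hbS (act_adjugate_zero_sq _) (act_adjugate_two_sq _) hc hq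
  have hrel' := smul_eq_smul_of_neighbours (clsI (a : QBar) (2 * S + 6)) _ hrel (by
    rw [map_sum]
    exact Finset.sum_eq_zero fun i _ => by
      rw [clsI_elemI _ _ _ (hcS i), cls_eq_zero (by omega) _ (hc' i)])
  have e₁ := (clsI_elemI (a : QBar) _ g hqS).trans (congrArg _ hq')
  have e₂ := (map_sum (clsI (a : QBar) (2 * S + 6)) (fun j => elemI ZBar _
    (g * incl (lineK j) * (heckeG 1)⁻¹) (X 0 ^ (2 * S + 4) * X 1 ^ 2)) Finset.univ).trans
    (Finset.sum_congr rfl fun j _ => (clsI_elemI (a : QBar) _ _ hmS).trans (congrArg _ hm'))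
  exact (congrArg _ e₁.symm).trans (hrel'.trans (congrArg _ e₂))

end Slope

/-! ### Invariance under `K` of the classes of X^{r-1}Y and θX^{r-4}Y -/

lemma act_congr {k k' : K} (h : ∀ i j, algebraMap ℤ_[2] FBar (k.1 i j) =
    algebraMap ℤ_[2] FBar (k'.1 i j)) : act FBar k = act FBar k' := by
  apply MvPolynomial.algHom_ext
  intro j
  simp only [act_X, h]

/-- `θ ∑ X^{n-j} Y^j = X Y^{n+2} - X^{n+2} Y` up to sign. -/
lemma X_mul_X_pow_sub_mem_Wone (S : ℕ) :
    (X 0 * X 1 ^ (2 * S + 5) - X 0 ^ (2 * S + 5) * X 1 : Poly FBar) ∈ Wone (2 * S + 6) := by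
  have h2 : (1 : FBar) + 1 = 0 := by rw [one_add_one_eq_two, two_eq_zero]
  set u : Poly FBar := ∑ i ∈ Finset.range (2 * S + 4), X 0 ^ i * X 1 ^ (2 * S + 4 - 1 - i) with hu
  have hmul : u * (X 0 - X 1) = X 0 ^ (2 * S + 4) - X 1 ^ (2 * S + 4) := geom_sum₂_mul _ _ _
  have huV : u ∈ V (2 * S + 3) := Submodule.sum_mem _ fun i hi =>
    X_pow_mul_X_pow_mem_Sym (by have := Finset.mem_range.1 hi; omega)
  have h10 := congrArg (eval ![1, 0]) hmul
  have h01 := congrArg (eval ![0, 1]) hmul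
  -- The sum u has 2S + 4 terms, an even number because r is even. Its values at (1, 0) and (0, 1)
  -- are both 1, so `middle` is 0.
  have h11 : eval ![1, 1] u = 0 := by
    simp only [hu, map_sum, map_mul, map_pow, eval_X, Matrix.cons_val_zero, Matrix.cons_val_one,
      one_pow, mul_one, Finset.sum_const, Finset.card_range, nsmul_eq_mul]
    push_cast
    linear_combination ((S : FBar) + 2) * two_eq_zero
  simp at h10 h01
  have hmid : middle (2 * S + 3) u = 0 := by
    rw [middle_eq (by omega) huV, h11, h10, h01, zero_add, h2]
  have h := Submodule.neg_mem _ (θ_mul_mem_Wone (r := 2 * S + 6) (by omega) huV hmid)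
  convert h using 1
  have : θ = X 0 * X 1 * (X 0 - X 1) := by rw [θ]; ring
  rw [this]
  linear_combination (X 0 * X 1) * hmul

section Slope

variable {a α : ZBar} {S : ℕ}

lemma cls_X_one_pow {N : ℕ} (ha : a = 2 * α) (g : G) :
    cls (a : QBar) (N + 6) g (X 1 ^ (N + 6)) = 0 := by
  have hX : (X 0 ^ (N + 6) : Poly FBar) ∈ V (N + 6) := by
    simpa using X_pow_mul_X_pow_mem_Sym (R := FBar) (Nat.add_zero (N + 6))
  have h := cls_X_zero_pow (N := N) ha (g * incl swapK)
  rwa [cls_mul_incl _ _ _ hX, map_pow, act_swapK_X_zero] at h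

lemma cls_mul_swapK (g : G) :
    cls (a : QBar) (2 * S + 6) (g * incl swapK) (X 0 ^ (2 * S + 5) * X 1) =
      cls (a : QBar) (2 * S + 6) g (X 0 ^ (2 * S + 5) * X 1) := by
  have hA : (X 0 ^ (2 * S + 5) * X 1 : Poly FBar) ∈ V (2 * S + 6) := by
    simpa using X_pow_mul_X_pow_mem_Sym (R := FBar) (show 2 * S + 5 + 1 = _ from rfl)
  have h : act FBar (swapK : Matrix (Fin 2) (Fin 2) ℤ_[2]) (X 0 ^ (2 * S + 5) * X 1) =
      (X 0 * X 1 ^ (2 * S + 5) - X 0 ^ (2 * S + 5) * X 1) + X 0 ^ (2 * S + 5) * X 1 := by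
    rw [map_mul, map_pow, act_swapK_X_zero, act_swapK_X_one]
    ring
  rw [cls_mul_incl _ _ _ hA, h, map_add,
    cls_eq_zero (by omega) g (X_mul_X_pow_sub_mem_Wone S), zero_add]

/-- The matrix `(1 1; 0 1)` in `K`. -/
def upperK : K := Matrix.GeneralLinearGroup.mk'' !![1, 1; 0, 1] (by simp [Matrix.det_fin_two_of])

lemma coe_upperK : (upperK : Matrix (Fin 2) (Fin 2) ℤ_[2]) = !![1, 1; 0, 1] := rfl

/-- X^{r-1}(X + Y) differs from X^{r-1}Y by X^r, whose class is zero. The form X^r need not lie in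
W, so this invariance uses T and not only the filtration. -/
lemma cls_mul_upperK (ha : a = 2 * α) (g : G) :
    cls (a : QBar) (2 * S + 6) (g * incl upperK) (X 0 ^ (2 * S + 5) * X 1) =
      cls (a : QBar) (2 * S + 6) g (X 0 ^ (2 * S + 5) * X 1) := by
  have hA : (X 0 ^ (2 * S + 5) * X 1 : Poly FBar) ∈ V (2 * S + 6) := by
    simpa using X_pow_mul_X_pow_mem_Sym (R := FBar) (show 2 * S + 5 + 1 = _ from rfl)
  have h : act FBar upperK.1 (X 0 ^ (2 * S + 5) * X 1) =
      X 0 ^ (2 * S + 6) + X 0 ^ (2 * S + 5) * X 1 := by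
    rw [map_mul, map_pow]
    simp [coe_upperK, act_of_X_zero, act_of_X_one]
    ring
  rw [cls_mul_incl _ _ _ hA, h, map_add, cls_X_zero_pow ha g, zero_add]

/-- The matrices `1`, `s`, `u`, `sus`, `us`, `su` represent all classes of `K` modulo `2`. -/
lemma exists_word (k : K) : ∃ k' ∈ Subgroup.closure {swapK, upperK}, act FBar k = act FBar k' := by
  have hs : swapK ∈ Subgroup.closure {swapK, upperK} := Subgroup.subset_closure (by simp)
  have hu : upperK ∈ Subgroup.closure {swapK, upperK} := Subgroup.subset_closure (by simp)
  rcases bits k _ _ _ _ rfl rfl rfl rfl with h | h | h | h | h | h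
  · refine ⟨1, one_mem _, act_congr ?_⟩
    simp [Fin.forall_fin_two, h]
  · refine ⟨_, hs, act_congr ?_⟩
    simp [Fin.forall_fin_two, h, coe_swapK]
  · refine ⟨_, hu, act_congr ?_⟩
    simp [Fin.forall_fin_two, h, coe_upperK]
  · refine ⟨_, mul_mem (mul_mem hs hu) hs, act_congr ?_⟩
    simp [Fin.forall_fin_two, h, coe_upperK, coe_swapK]
  · refine ⟨_, mul_mem hu hs, act_congr ?_⟩
    simp [Fin.forall_fin_two, h, coe_upperK, coe_swapK]
  · refine ⟨_, mul_mem hs hu, act_congr ?_⟩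
    simp [Fin.forall_fin_two, h, coe_upperK, coe_swapK]

/-- The action on forms over 𝔽̄₂ depends only on k modulo 2, and GL₂(𝔽₂) is generated by the classes
of `swapK` and `upperK`. Invariance under these two at every vertex suffices. -/
lemma cls_mul_incl_eq (ha : a = 2 * α) (g : G) (k : K) :
    cls (a : QBar) (2 * S + 6) (g * incl k) (X 0 ^ (2 * S + 5) * X 1) =
      cls (a : QBar) (2 * S + 6) g (X 0 ^ (2 * S + 5) * X 1) := by
  have hA : (X 0 ^ (2 * S + 5) * X 1 : Poly FBar) ∈ V (2 * S + 6) := by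
    simpa using X_pow_mul_X_pow_mem_Sym (R := FBar) (show 2 * S + 5 + 1 = _ from rfl)
  obtain ⟨k', hk', h⟩ := exists_word k
  rw [cls_mul_incl _ _ _ hA, h, ← cls_mul_incl _ _ _ hA]
  clear h
  induction hk' using Subgroup.closure_induction generalizing g with
  | mem x hx =>
    rcases hx with rfl | rfl
    · exact cls_mul_swapK g
    · exact cls_mul_upperK ha g
  | one => rw [map_one incl, mul_one]
  | mul x y _ _ ihx ihy => rw [map_mul incl, ← mul_assoc, ihy, ihx]
  | inv x _ ih => 
    rw [← ih (g * incl x⁻¹), mul_assoc g, ← map_mul incl, inv_mul_cancel, map_one incl, mul_one]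

/-- `K` acts trivially on V_r^{(1)} / W, because θ and `middle` are invariant. -/
lemma cls_θ_mul_incl (a : QBar) (g : G) (k : K) :
    cls a (2 * S + 6) (g * incl k) (θ * (X 0 ^ (2 * S + 2) * X 1)) =
      cls a (2 * S + 6) g (θ * (X 0 ^ (2 * S + 2) * X 1)) := by
  have hA : (X 0 ^ (2 * S + 2) * X 1 : Poly FBar) ∈ V (2 * S + 3) := by
    simpa using X_pow_mul_X_pow_mem_Sym (R := FBar) (show 2 * S + 2 + 1 = _ from rfl)
  rw [cls_mul_incl _ _ _ (Vfil_one_le _ (θ_mul_mem_Vfil_one (by omega) hA)), map_mul, act_θ,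
    ← sub_eq_zero, ← map_sub, ← mul_sub]
  refine cls_eq_zero (by omega) g (θ_mul_mem_Wone (by omega)
    (Submodule.sub_mem _ (act_mem_Sym _ hA) hA) ?_)
  rw [map_sub, Nat.add_sub_assoc (by omega)]
  exact sub_eq_zero.2 (middle_act _ k hA)

/-- The αᵢ all lie in the double coset K α₁ K. Together with `K`-invariance this carries the
relation at g α₁ to every neighbour. -/
lemma exists_heckeG_eq (i : Fin 3) : ∃ k k' : K, heckeG i = incl k * heckeG 1 * incl k' := by
  obtain ⟨k, hk⟩ := exists_K (M := (!![1, -1; 0, 1] : Matrix (Fin 2) (Fin 2) ℤ_[2]))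
    (by simp [Matrix.det_fin_two_of])
  have key : ∀ k k' : K, heckeMat i = k.1 * heckeMat 1 * k'.1 →
      ∃ k k' : K, heckeG i = incl k * heckeG 1 * incl k' := fun k k' h => ⟨k, k', by
    apply Units.ext
    have := congrArg (algebraMap ℤ_[2] ℚ_[2]).mapMatrix h
    rw [map_mul, map_mul] at this
    exact this⟩
  fin_cases i
  · refine key k 1 ?_
    rw [hk]
    simp [heckeMat]
  · exact key 1 1 (by simp)
  · refine key (swapK * k) swapK ?_
    rw [Units.val_mul, hk, coe_swapK]
    simp [heckeMat]

/-- Adjacency in the tree is symmetric: 2αᵢ⁻¹ is the adjugate of αᵢ, an integral matrix of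
determinant 2, so it lies in some coset αⱼ K. -/
lemma exists_heckeG_inv_eq (i : Fin 3) :
    ∃ (j : Fin 3) (k : K), (heckeG i)⁻¹ = heckeG j * incl k * two⁻¹ := by
  obtain ⟨j, k, h⟩ := exists_row (heckeMat i).adjugate isUnit_one
    (by rw [Matrix.det_adjugate, det_heckeMat]; simp)
  have h0 : heckeMat j * k = ((1 : K) : Matrix (Fin 2) (Fin 2) ℤ_[2]) * (heckeMat i).adjugate := by
    rw [Units.val_one, one_mul, h]
  have h1 := heckeG_eq_adj h0
  rw [map_one, one_mul] at h1
  refine ⟨j, k, ?_⟩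
  rw [eq_mul_inv_iff_mul_eq, ← two_comm, ← h1, mul_inv_cancel_right]

/-- For all neighbours `g α` of `g`: `[g α, X^{r-1} Y] = λ [g, θ X^{r-4} Y]`. -/
lemma cls_mul_heckeG (ha : a = 2 * α) (g : G) (i : Fin 3) :
    cls (a : QBar) (2 * S + 6) (g * heckeG i) (X 0 ^ (2 * S + 5) * X 1) =
      algebraMap ZBar FBar α •
        cls (a : QBar) (2 * S + 6) g (θ * (X 0 ^ (2 * S + 2) * X 1)) := by
  obtain ⟨k, k', h⟩ := exists_heckeG_eq i
  rw [h, ← mul_assoc, cls_mul_incl_eq ha, ← mul_assoc, cls_heckeG_one ha, cls_θ_mul_incl]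

lemma cls_mul_heckeG_inv (ha : a = 2 * α) (g : G) (i : Fin 3) :
    cls (a : QBar) (2 * S + 6) (g * (heckeG i)⁻¹) (X 0 ^ (2 * S + 5) * X 1) =
      algebraMap ZBar FBar α •
        cls (a : QBar) (2 * S + 6) g (θ * (X 0 ^ (2 * S + 2) * X 1)) := by
  obtain ⟨j, k, h⟩ := exists_heckeG_inv_eq i
  rw [← cls_mul_two, h, ← mul_assoc, inv_mul_cancel_right, ← mul_assoc, cls_mul_incl_eq ha,
    cls_mul_heckeG ha]

/-! ### The Hecke relation for the class of θX^{r-4}Y -/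

lemma sum_const_three {M : Type*} [AddCommGroup M] [Module FBar M] (x : M) :
    ∑ _i : Fin 3, x = x := by
  rw [Fin.sum_univ_three, two_smul_FBar, zero_add]

/-- The first two relations give A = c²e, as 3 = 1. The third, summed over i, gives A = c ∑ fᵢ; then
one factor c cancels. -/
lemma sum_eq_smul_of_relations {M : Type*} [AddCommGroup M] [Module FBar M] {c : FBar} (hc : c ≠ 0)
    {A e : M} {B f : Fin 3 → M} (h : c • A = c ^ 2 • ∑ j, B j) (hB : ∀ j, B j = c • e)
    (hf : ∀ i, A = c • f i) : ∑ i, f i = c • e := by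
  have h1 : A = c • c • e := by
    refine smul_right_injective _ hc ?_
    change c • A = c • c • c • e
    rw [h, Finset.sum_congr rfl fun j _ => hB j, sum_const_three, sq, mul_smul]
  refine smul_right_injective _ hc ?_
  change c • ∑ i, f i = c • c • e
  rw [Finset.smul_sum, ← Finset.sum_congr rfl fun i _ => hf i, sum_const_three, h1]

lemma cls_X_pow_add_X_pow_sub (ha : a = 2 * α) (g : G) :
    cls (a : QBar) (2 * S + 6) g
      (X 0 ^ (2 * S + 6) + X 1 ^ (2 * S + 6) - X 0 ^ (2 * S + 4) * X 1 ^ 2) =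
      cls (a : QBar) (2 * S + 6) g (X 0 ^ (2 * S + 5) * X 1) := by
  have h := map_sub (cls (a : QBar) (2 * S + 6) g) (X 0 ^ (2 * S + 6) + X 1 ^ (2 * S + 6))
    (X 0 ^ (2 * S + 4) * X 1 ^ 2)
  refine h.trans ?_
  rw [map_add, cls_X_zero_pow ha g, cls_X_one_pow ha g, cls_X_zero_sq g, zero_add,
    zero_sub, neg_eq_iff_add_eq_zero]
  exact two_smul_FBar _

/-- `T - λ` kills the class of `θ X^{r-4} Y`. -/
lemma sum_cls_θ (ha : a = 2 * α) (hα : algebraMap ZBar FBar α ≠ 0) (g : G) :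
    ∑ i, cls (a : QBar) (2 * S + 6) (g * heckeG i) (θ * (X 0 ^ (2 * S + 2) * X 1)) =
      algebraMap ZBar FBar α •
        cls (a : QBar) (2 * S + 6) g (θ * (X 0 ^ (2 * S + 2) * X 1)) := by
  have h1 := (congrArg _ (cls_X_pow_add_X_pow_sub (S := S) ha g).symm).trans
    (cls_neighbours (S := S) ha g)
  refine sum_eq_smul_of_relations hα h1 (fun j => ?_) fun i => ?_
  · exact (cls_X_zero_sq _).trans ((cls_mul_heckeG_inv ha _ 1).trans
      (congrArg _ (cls_θ_mul_incl _ g _)))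
  -- The adjacency relation is read at the vertex g αᵢ, of which g is a neighbour.
  · have h := cls_mul_heckeG_inv (S := S) ha (g * heckeG i) i
    rwa [mul_inv_cancel_right] at h

end Slope

/-! ### Factorization through `π(0, λ, 1)` -/

/-- 𝓕'₃ embeds in Θ̄ / 𝓕'₂, so vanishing may be tested there, where `cls` makes sense for all forms
and not only for multiples of θ. -/
lemma toF3'_eq_zero_iff {a : QBar} {r : ℕ} (hr : 3 ≤ r) (F : (cInd (V (r - 3))).toSubmodule) :
    toF3' a r hr F = 0 ↔ Submodule.mkQ (F2' a r).toSubmodule (P a r (θI r hr F)) = 0 := by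
  rw [Submodule.mkQ_apply, Submodule.Quotient.mk_eq_zero]
  exact Submodule.Quotient.mk_eq_zero _

lemma θI_elemI {r : ℕ} (hr : 3 ≤ r) (g : G) {u : Poly FBar} (hu : u ∈ V (r - 3)) :
    θI r hr (elemI FBar (r - 3) g u) = elemI FBar r g (θ * u) := by
  classical
  apply Subtype.ext
  rw [coe_elemI _ (Vfil_one_le _ (θ_mul_mem_Vfil_one hr hu))]
  change (fun x => θ * (elemI FBar (r - 3) g u).1 x) = _
  rw [coe_elemI _ hu]
  funext x
  by_cases h : x * g ∈ KZ
  · rw [elem, elem, if_pos h, if_pos h, map_mul, act_θ]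
  · rw [elem, elem, if_neg h, if_neg h, mul_zero]

lemma C_mem_Sym_zero (c : FBar) : (C c : Poly FBar) ∈ V 0 :=
  (mem_homogeneousSubmodule _ _).2 (isHomogeneous_C _ _)

lemma projI_elemI {n : ℕ} (g : G) {u : Poly FBar} (hu : u ∈ V n) :
    projI n (elemI FBar n g u) = elemI FBar 0 g (C (middle n u)) := by
  classical
  apply Subtype.ext
  rw [coe_elemI _ (C_mem_Sym_zero _)]
  change (fun x => C (middle n ((elemI FBar n g u).1 x))) = _
  rw [coe_elemI _ hu]
  funext x
  by_cases h : x * g ∈ KZ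
  · rw [elem, elem, if_pos h, if_pos h, act_C, middle_act _ _ hu]
  · rw [elem, elem, if_neg h, if_neg h, map_zero, map_zero]

lemma middle_X_pow_mul_X {n : ℕ} (hn : 2 ≤ n) : middle n (X 0 ^ (n - 1) * X 1 ^ 1) = 1 := by
  rw [middle_eq (by omega) (X_pow_mul_X_pow_mem_Sym (by omega))]
  simp [show n - 1 ≠ 0 by omega]

/-- If `middle` kills every value of F, then θF takes its values in W and P(θF) ∈ 𝓕'₂. -/
lemma toF3'_eq_zero_of_projI_eq_zero {a : QBar} {r : ℕ} (hr : 6 ≤ r) (hr' : 3 ≤ r)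
    {F : (cInd (V (r - 3))).toSubmodule} (h : projI (r - 3) F = 0) : toF3' a r hr' F = 0 := by
  rw [toF3'_eq_zero_iff, Submodule.mkQ_apply, Submodule.Quotient.mk_eq_zero]
  refine ⟨θI r hr' F, ?_, rfl⟩
  have h1 := θ_mul_mem hr' F.2
  refine ⟨fun x => θ_mul_mem_Wone hr (F.2.1 x) ?_, h1.2⟩
  have h2 : C (middle (r - 3) (F.1 x)) = (0 : Poly FBar) := congrFun (congrArg Subtype.val h) x
  rwa [map_eq_zero_iff _ (C_injective _ _)] at h2

lemma elemI_induction {r : ℕ} {p : (cInd (V r)).toSubmodule → Prop} (F : (cInd (V r)).toSubmodule)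
    (helem : ∀ g, ∀ v ∈ V r, p (elemI FBar r g v)) (zero : p 0)
    (add : ∀ f f', p f → p f' → p (f + f')) (smul : ∀ (c : FBar) f, p f → p (c • f)) : p F := by
  obtain ⟨f, hf⟩ := F
  have h := cInd_le_span_elem (fun (k : K) _ hv => act_mem_Sym k.1 hv) hf
  suffices hs : ∀ (hf : f ∈ (cInd (V r)).toSubmodule), p ⟨f, hf⟩ from hs hf
  clear hf
  -- Membership is packed into an existential so that the predicate makes sense on bare functions
  -- and span induction applies.
  suffices hs : ∃ hf : f ∈ (cInd (V r)).toSubmodule, p ⟨f, hf⟩ from fun _ => hs.2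
  induction h using Submodule.span_induction with
  | mem x hx =>
    obtain ⟨g, v, hv, rfl⟩ := hx
    refine ⟨coe_elemI g hv ▸ (elemI FBar r g v).2, ?_⟩
    convert helem g v hv
    exact (coe_elemI g hv).symm
  | zero => exact ⟨Submodule.zero_mem _, zero⟩
  | add x y _ _ hx hy =>
    obtain ⟨hx, hpx⟩ := hx
    obtain ⟨hy, hpy⟩ := hy
    exact ⟨Submodule.add_mem _ hx hy, add _ _ hpx hpy⟩
  | smul c x _ hx =>
    obtain ⟨hx, hpx⟩ := hx
    exact ⟨Submodule.smul_mem _ c hx, smul c _ hpx⟩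

lemma eq_C_of_mem_V_zero {v : Poly FBar} (hv : v ∈ V 0) : ∃ c, v = C c :=
  ⟨_, totalDegree_eq_zero_iff_eq_C.1 (Nat.le_zero.1
    ((mem_homogeneousSubmodule _ _).1 hv).totalDegree_le)⟩

lemma projI_surjective {n : ℕ} (hn : 2 ≤ n) : Function.Surjective (projI n) := by
  intro f
  induction f using elemI_induction with
  | helem g v hv =>
    obtain ⟨c, rfl⟩ := eq_C_of_mem_V_zero hv
    refine ⟨elemI FBar n g (c • (X 0 ^ (n - 1) * X 1 ^ 1)), ?_⟩
    rw [projI_elemI g (Submodule.smul_mem _ c (X_pow_mul_X_pow_mem_Sym (by omega))), map_smul,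
      middle_X_pow_mul_X hn, smul_eq_mul, mul_one]
  | zero => exact ⟨0, map_zero _⟩
  | add f f' hf hf' =>
    obtain ⟨F, rfl⟩ := hf
    obtain ⟨F', rfl⟩ := hf'
    exact ⟨F + F', map_add _ _ _⟩
  | smul c f hf =>
    obtain ⟨F, rfl⟩ := hf
    exact ⟨c • F, map_smul _ _ _⟩

lemma map_smul_sum_sub_eq_zero {M Q : Type*} [AddCommGroup M] [Module FBar M] [AddCommGroup Q]
    [Module FBar Q] (L : M →ₗ[FBar] Q) (c d : FBar) (x : Fin 3 → M) (y : M)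
    (h : ∑ i, L (x i) = d • L y) : L (c • (∑ i, x i - d • y)) = 0 := by
  rw [map_smul, map_sub, map_sum, h, map_smul, sub_self, smul_zero]

/-- Each element of (T - λ)𝓘(V₀) has some lift that dies in 𝓕'₃; on [g, c] the lift is built from
X^{r-4}Y, whose `middle` is 1, and dies by `sum_cls_θ`. One lift suffices, since two lifts differ by
an element of the kernel of `projI`. -/
lemma exists_projI_eq {a α : ZBar} {S : ℕ} (ha : a = 2 * α) (hα : algebraMap ZBar FBar α ≠ 0)
    (f : (cInd (V 0)).toSubmodule) :
    ∃ F, projI (2 * S + 6 - 3) F = heckeI FBar 0 f - algebraMap ZBar FBar α • f ∧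
      toF3' (a : QBar) (2 * S + 6) (by omega) F = 0 := by
  induction f using elemI_induction with
  | helem g v hv =>
    obtain ⟨c, rfl⟩ := eq_C_of_mem_V_zero hv
    have hu : (X 0 ^ (2 * S + 2) * X 1 ^ 1 : Poly FBar) ∈ V (2 * S + 6 - 3) :=
      X_pow_mul_X_pow_mem_Sym (by omega)
    have hmid : middle (2 * S + 6 - 3) (X 0 ^ (2 * S + 2) * X 1 ^ 1) = 1 :=
      middle_X_pow_mul_X (n := 2 * S + 3) (by omega)
    have hproj : ∀ h, projI (2 * S + 6 - 3) (elemI FBar _ h (X 0 ^ (2 * S + 2) * X 1 ^ 1)) =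
        elemI FBar 0 h (C 1) := fun h => by rw [projI_elemI h hu, hmid]
    refine ⟨c • (∑ i, elemI FBar _ (g * heckeG i) (X 0 ^ (2 * S + 2) * X 1 ^ 1) -
      algebraMap ZBar FBar α • elemI FBar _ g (X 0 ^ (2 * S + 2) * X 1 ^ 1)), ?_, ?_⟩
    · have hC : (C c : Poly FBar) = c • C 1 := by rw [MvPolynomial.smul_eq_C_mul, C_1, mul_one]
      rw [map_smul, map_sub, map_sum, map_smul, hproj, Finset.sum_congr rfl fun i _ => hproj _,
        hC, map_smul, map_smul, heckeI_elemI g (C_mem_Sym_zero 1), smul_sub,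
        smul_comm c (algebraMap ZBar FBar α)]
      simp only [act_C]
    · rw [toF3'_eq_zero_iff]
      have hcls : ∀ h, Submodule.mkQ (F2' (a : QBar) (2 * S + 6)).toSubmodule
          (P (a : QBar) (2 * S + 6) (θI (2 * S + 6) (by omega)
            (elemI FBar _ h (X 0 ^ (2 * S + 2) * X 1 ^ 1)))) =
          cls (a : QBar) (2 * S + 6) h (θ * (X 0 ^ (2 * S + 2) * X 1)) := fun h => by
        rw [θI_elemI _ h hu, pow_one]
        rfl
      refine map_smul_sum_sub_eq_zero (Submodule.mkQ (F2' (a : QBar) (2 * S + 6)).toSubmodule ∘ₗ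
        P (a : QBar) (2 * S + 6) ∘ₗ θI (2 * S + 6) (by omega)) c _ _ _ ?_
      exact (Finset.sum_congr rfl fun i _ => hcls _).trans
        ((sum_cls_θ (S := S) ha hα g).trans (congrArg _ (hcls g).symm))
  | zero => exact ⟨0, by simp, map_zero _⟩
  | add f f' hf hf' =>
    obtain ⟨F, h1, h2⟩ := hf
    obtain ⟨F', h1', h2'⟩ := hf'
    refine ⟨F + F', ?_, by rw [map_add, h2, h2', add_zero]⟩
    rw [map_add, h1, h1', map_add, smul_add]
    abel
  | smul c f hf =>
    obtain ⟨F, h1, h2⟩ := hf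
    refine ⟨c • F, ?_, by rw [map_smul, h2, smul_zero]⟩
    rw [map_smul, h1, map_smul, smul_sub, smul_comm]

lemma toF3'_eq_zero {a α : ZBar} {S : ℕ} (ha : a = 2 * α) (hα : algebraMap ZBar FBar α ≠ 0)
    {F : (cInd (V (2 * S + 6 - 3))).toSubmodule}
    (h : toPi 0 (algebraMap ZBar FBar α) (projI (2 * S + 6 - 3) F) = 0) :
    toF3' (a : QBar) (2 * S + 6) (by omega) F = 0 := by
  obtain ⟨f, hf, hfF⟩ := (Submodule.Quotient.mk_eq_zero _).1 h
  obtain ⟨F', h1, h2⟩ := exists_projI_eq (S := S) ha hα ⟨f, hf⟩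
  rw [← sub_add_cancel F F', map_add, h2, add_zero]
  refine toF3'_eq_zero_of_projI_eq_zero (by omega) _ ?_
  rw [map_sub, h1, sub_eq_zero]
  exact Subtype.ext hfF.symm

/-! ### Surjectivity, equivariance and conclusion -/

lemma θ_ne_zero : θ ≠ 0 := by
  intro h
  have h2 : θ = X 0 * X 1 * (X 0 - X 1) := by rw [θ]; ring
  rw [h2] at h
  simp only [mul_eq_zero, X_ne_zero, false_or, sub_eq_zero] at h
  exact absurd (X_injective h) (by decide)

/-- An element of 𝓘(V_r^{(1)}) can be divided by θ pointwise. The quotients are unique because the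
polynomial ring is a domain, so they inherit the equivariance. -/
lemma toF3'_surjective (a : QBar) {r : ℕ} (hr : 3 ≤ r) : Function.Surjective (toF3' a r hr) := by
  intro y
  obtain ⟨⟨z, f, hf, rfl⟩, rfl⟩ := Submodule.mkQ_surjective _ y
  obtain ⟨h1, h2, h3, S, hS⟩ := mem_cInd.1 (show (f : G → Poly FBar) ∈ _ from hf)
  have hdvd : ∀ x, ∃ u ∈ V (r - 3), f.1 x = θ * u := by
    intro x
    have h := h1 x
    rw [Vfil, if_pos (by omega)] at h
    obtain ⟨u, hu, h⟩ := h
    exact ⟨u, hu, by rw [← h]; simp⟩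
  choose u hu hfu using hdvd
  refine ⟨⟨u, hu, fun k x => ?_, fun x => ?_, S, fun x hx => hS x ?_⟩, ?_⟩
  · refine mul_left_cancel₀ θ_ne_zero ?_
    rw [← hfu, ← act_θ k, ← map_mul, ← hfu, h2]
  · refine mul_left_cancel₀ θ_ne_zero ?_
    rw [← hfu, ← hfu, h3]
  · rw [hfu]
    exact mul_ne_zero θ_ne_zero hx
  · refine congrArg (Submodule.mkQ _) (Subtype.ext (congrArg (P a r) (Subtype.ext ?_)))
    funext x
    exact (hfu x).symm

lemma toF3'_translation (a : QBar) {r : ℕ} (hr : 3 ≤ r) (g : G)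
    (F : (cInd (V (r - 3))).toSubmodule) :
    toF3' a r hr ((cInd (V (r - 3))).toRepresentation g F) = F3'Rep a r g (toF3' a r hr F) :=
  congrArg (Submodule.mkQ _) (Subtype.ext (P_translation a r g (θI r hr F)))

/-- An equivariant map that vanishes on the kernel of a surjective equivariant map `q` factors
through `q`. -/
lemma exists_intertwiningMap {A H U V W : Type*} [CommRing A] [Monoid H] [AddCommGroup U]
    [Module A U] [AddCommGroup V] [Module A V] [AddCommGroup W] [Module A W]
    {ρ : Representation A H U} {σ : Representation A H V} {τ : Representation A H W}
    (q : U →ₗ[A] V) (Ψ : U →ₗ[A] W) (hq : Function.Surjective q) (hΨ : Function.Surjective Ψ)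
    (hqρ : ∀ g u, q (ρ g u) = σ g (q u)) (hΨρ : ∀ g u, Ψ (ρ g u) = τ g (Ψ u))
    (h : ∀ u, q u = 0 → Ψ u = 0) :
    ∃ φ : σ.IntertwiningMap τ, Function.Surjective φ ∧ ∀ u, φ (q u) = Ψ u := by
  let φ := (LinearMap.ker q).liftQ Ψ h ∘ₗ (q.quotKerEquivOfSurjective hq).symm.toLinearMap
  have hφ : ∀ u, φ (q u) = Ψ u := by
    intro u
    have : (q.quotKerEquivOfSurjective hq).symm (q u) = Submodule.Quotient.mk u := by
      rw [LinearEquiv.symm_apply_eq]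
      rfl
    change (LinearMap.ker q).liftQ Ψ h ((q.quotKerEquivOfSurjective hq).symm (q u)) = _
    rw [this]
    rfl
  refine ⟨⟨φ, fun g => LinearMap.ext fun x => ?_⟩, fun w => ?_, hφ⟩
  · obtain ⟨u, rfl⟩ := hq x
    change φ (σ g (q u)) = τ g (φ (q u))
    rw [← hqρ, hφ, hφ, hΨρ]
  · obtain ⟨u, rfl⟩ := hΨ w
    exact ⟨q u, hφ u⟩

lemma algebraMap_ne_zero_of_norm_eq_one {α : ZBar} (h : ‖(α : QBar)‖ = 1) :
    algebraMap ZBar FBar α ≠ 0 := by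
  have h0 : (α : QBar) ≠ 0 := norm_ne_zero_iff.1 (by rw [h]; exact one_ne_zero)
  have hu : IsUnit α := IsUnit.of_mul_eq_one ⟨(α : QBar)⁻¹, by
    rw [mem_ZBar, norm_inv, h, inv_one]⟩ (Subtype.ext (mul_inv_cancel₀ h0))
  exact (hu.map (algebraMap ZBar FBar)).ne_zero

end BT2

end

open BT2 in
theorem propositionF3 (r : ℕ) (hr : 6 ≤ r) (hev : Even r) (a : QBar) (ha : ‖a‖ = ‖(2 : QBar)‖) :
    ∃ φ : (piRep 0 (halfResidue a ha)).IntertwiningMap (F3'Rep a r),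
      Function.Surjective φ ∧ ∀ F : (cInd (V (r - 3))).toSubmodule,
        φ (toPi 0 (halfResidue a ha) (projI (r - 3) F)) = toF3' a r (by omega) F := by
  obtain ⟨S, rfl⟩ : ∃ S, r = 2 * S + 6 := by
    obtain ⟨s, hs⟩ := hev
    exact ⟨s - 3, by omega⟩
  have h2 : ‖(2 : QBar)‖ ≠ 0 := norm_ne_zero_iff.2 two_ne_zero
  have hmem : a / 2 ∈ ZBar := by
    rw [mem_ZBar, norm_div, ha]
    exact div_self_le_one _
  have hne : algebraMap ZBar FBar ⟨a / 2, hmem⟩ ≠ 0 :=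
    algebraMap_ne_zero_of_norm_eq_one (by rw [norm_div, ha, div_self h2])
  -- The relations were proved for a of the form 2α with α ∈ ℤ̄₂; here α = a/2, whose residue is
  -- `halfResidue a ha`.
  have haα : ((2 * ⟨a / 2, hmem⟩ : ZBar) : QBar) = a := mul_div_cancel₀ _ two_ne_zero
  refine exists_intertwiningMap (ρ := (cInd (V (2 * S + 6 - 3))).toRepresentation)
    (toPi 0 (halfResidue a ha) ∘ₗ projI (2 * S + 6 - 3)) (toF3' a (2 * S + 6) (by omega))
    ((Submodule.mkQ_surjective _).comp (projI_surjective (by omega)))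
    (toF3'_surjective a (by omega)) (fun _ _ => rfl) (toF3'_translation a (by omega)) fun F hF => ?_
  have h := toF3'_eq_zero (S := S) rfl hne hF
  rwa [haα] at h
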